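/- Let $G$ be a connected, simply connected, simple, complex linear algebraic group, $T\subseteq B\subseteq P\subseteq G$ a maximal torus, a Borel subgroup and a parabolic subgroup, and $X=G/P$. Let $R$ be the root system of $(G,T)$ (an arbitrary reduced irreducible crystallographic root system), $\Delta$ its base given by $B$, $\Delta_P\subseteq\Delta$ the subset given by $P$ (an arbitrary subset), $R^+$ the positive roots, $R_P=R\cap\mathbb{Z}\Delta_P$ with positive roots $R_P^+$, $R^-=-R^+$, $R_P^-=-R_P^+$, $W$ the Weyl group with its length function $\ell$ and Bruhat order $\leq$, $w_P$ the longest element of the subgroup $W_P$ generated by the simple reflections of $\Delta_P$, and $(-,-)$ a $W$-invariant scalar product on $\mathbb{R}\Delta$. Write $\cdot$ for the Hecke product on $W$, i.e. the associative product with $u\cdot s=us$ if $\ell(us)>\ell(u)$ and $u\cdot s=u$ otherwise, for $u\in W$ and every simple reflection $s$, and $u\cdot v=u\cdot s_1\cdot\ldots\cdot s_r$ for every reduced word $v=s_1\cdots s_r$. For $\alpha,\beta\in R$ write $\alpha\leq\beta$ if $\beta-\alpha$ is a nonnegative integral combination of $\Delta$. Identify $H_2(X)=\mathbb{Z}\Delta^\vee/\mathbb{Z}\Delta_P^\vee$;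 its effective classes, called degrees, are the nonnegative integral combinations of the classes $\beta^\vee+\mathbb{Z}\Delta_P^\vee$, $\beta\in\Delta$, and $d\leq d'$ means that $d'-d$ is effective. A maximal root of a degree $d$ is a maximal element of $\{\alpha\in R^+\setminus R_P^+\mid\alpha^\vee+\mathbb{Z}\Delta_P^\vee\leq d\}$. A sequence $(\alpha_1,\ldots,\alpha_r)$ is a greedy decomposition of $d$ if $\alpha_1$ is a maximal root of $d$ and $(\alpha_2,\ldots,\alpha_r)$ is a greedy decomposition of $d-(\alpha_1^\vee+\mathbb{Z}\Delta_P^\vee)$; the empty sequence is the unique greedy decomposition of $0$. Define $z_d^P\in W$ by $z_d^Pw_P=s_{\alpha_1}\cdot\ldots\cdot s_{\alpha_r}\cdot w_P$ for any greedy decomposition $(\alpha_1,\ldots,\alpha_r)$ of $d$ (it does not depend on the choice). A degree $d$ is minimal if it is a minimal element of the set of all degrees $d'$ with $z_d^P\leq z_{d'}^P$; let $\Pi_P$ be the set of minimal degrees in $H_2(X)$, and $\Pi_B$ the set of those in $H_2(G/B)=\mathbb{Z}\Delta^\vee$. The lifting of $d\in\Pi_P$ is the unique $e\in\Pi_B$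 with $z_d^Pw_P=z_e^B$. For $e\in\Pi_B$ put $$\mathcal{B}_{R,e}=\{\alpha\in R^+\mid\alpha\text{ occurs in a greedy decomposition of }e\},$$ and for $d\in\Pi_P$ with lifting $e$ put $$\mathrm{TD}_{P,d}=\{-\alpha-\gamma\in R^-\setminus R_P^-\mid\alpha\in\mathcal{B}_{R,e}\setminus R_P^+,\ \gamma\in R_P^+\cup\{0\}\}.$$ **Theorem.** Let $d\in\Pi_P$, and let $e$ be the lifting of $d$. Then the assignment $(\alpha,\gamma)\mapsto-\alpha-\gamma$ gives a well-defined injective map $$\{(\alpha,\gamma)\in(\mathcal{B}_{R,e}\setminus R_P^+)\times R_P^+\mid(\alpha,\gamma)<0\}\hookrightarrow\mathrm{TD}_{P,d}\setminus\bigl(-(\mathcal{B}_{R,e}\setminus R_P^+)\bigr).$$ -/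

import Mathlib

open Set
open scoped Pointwise

/-! Combinatorics of degrees on a flag variety `X = G/P`, in terms of the root system `R` of `G`
(a `RootPairing` over `ℝ`, with roots indexed by `ι`), a base `Δ` (`b : P.Base`, so that
`Δ = P.root '' b.support`) and the subset `Δ_P ⊆ Δ` which belongs to the parabolic subgroup
(`J ⊆ b.support`). The Borel subgroup belongs to `J = ∅`. Roots are handled through their
indices. -/

namespace FlagDegree

noncomputable section

variable {ι M N : Type*} [AddCommGroup M] [Module ℝ M] [AddCommGroup N] [Module ℝ N]

/-- The (indices of the) roots which are sums of elements of `J`. For `J = b.support` this is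
`R⁺`; for `J ⊆ b.support` it is `R_P⁺`, the positive roots of `R_P` with respect to `Δ_P`. -/
def posRoots (P : RootPairing ι ℝ M N) (J : Set ι) : Set ι :=
  {i | P.root i ∈ AddSubmonoid.closure (P.root '' J)}

/-- `H₂(X) = ℤΔ^∨ / ℤΔ_P^∨`. -/
abbrev H2 (P : RootPairing ι ℝ M N) (J : Set ι) : Type _ :=
  P.corootSpan ℤ ⧸ (Submodule.span ℤ (P.coroot '' J)).submoduleOf (P.corootSpan ℤ)

/-- The class `α^∨ + ℤΔ_P^∨` of a coroot. -/
def corootClass (P : RootPairing ι ℝ M N) (J : Set ι) (i : ι) : H2 P J :=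
  Submodule.Quotient.mk (P.corootSpanMem ℤ i)

variable {P : RootPairing ι ℝ M N} (b : P.Base)

/-- The partial order on roots: `α ≤ β` iff `β - α` is a sum of positive (equivalently, of simple)
roots. -/
def RootLE (i j : ι) : Prop :=
  P.root j - P.root i ∈ AddSubmonoid.closure (P.root '' b.support)

/-- A degree is an effective class, that is, a nonnegative integer combination of the classes
`β^∨ + ℤΔ_P^∨` with `β ∈ Δ` (the classes of the one-dimensional Schubert varieties, and `0` for
`β ∈ Δ_P`). Equivalently, its coefficient at each `β ∈ Δ ∖ Δ_P` is nonnegative. -/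
def IsDegree (J : Set ι) (d : H2 P J) : Prop :=
  d ∈ AddSubmonoid.closure (corootClass P J '' b.support)

/-- The partial order on `H₂(X)`, with effective classes as its nonnegative elements. -/
def DegLE (J : Set ι) (d d' : H2 P J) : Prop :=
  IsDegree b J (d' - d)

/-! ### Greedy decompositions -/

/-- The roots `α ∈ R⁺ ∖ R_P⁺` with `α^∨ + ℤΔ_P^∨ ≤ d`. -/
def rootsBelow (J : Set ι) (d : H2 P J) : Set ι :=
  {i | i ∈ posRoots P b.support \ posRoots P J ∧ DegLE b J (corootClass P J i) d}

/-- A maximal root of `d`. -/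
def IsMaximalRoot (J : Set ι) (d : H2 P J) (i : ι) : Prop :=
  i ∈ rootsBelow b J d ∧ ∀ j ∈ rootsBelow b J d, RootLE b i j → j = i

/-- `IsGreedy b J l d`: the sequence of roots `l` is a greedy decomposition of `d`. -/
inductive IsGreedy (J : Set ι) : List ι → H2 P J → Prop
  | nil : IsGreedy J [] 0
  | cons {i : ι} {l : List ι} {d : H2 P J} :
      IsMaximalRoot b J d i → IsGreedy J l (d - corootClass P J i) → IsGreedy J (i :: l) d

/-! ### The Weyl group: length, Bruhat order, Hecke product -/

/-- `l` is a word in the simple reflections with product `w`. -/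
def IsWord (l : List b.support) (w : P.weylGroup) : Prop :=
  (l.map fun i : b.support => RootPairing.weylGroup.ofIdx P i.1).prod = w

/-- The length of a Weyl group element with respect to the simple reflections. -/
def length (w : P.weylGroup) : ℕ :=
  sInf {n | ∃ l : List b.support, IsWord b l w ∧ l.length = n}

/-- `l` is a reduced word of `w`. -/
def IsReducedWord (l : List b.support) (w : P.weylGroup) : Prop :=
  IsWord b l w ∧ l.length = length b w

/-- The Bruhat order: generated by `u < u s_α` for roots `α` with `ℓ(u) < ℓ(u s_α)`. -/
def BruhatLE : P.weylGroup → P.weylGroup → Prop :=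
  Relation.ReflTransGen fun u v =>
    ∃ i : ι, v = u * RootPairing.weylGroup.ofIdx P i ∧ length b u < length b v

open Classical in
/-- The Hecke product of `u` with a simple reflection `s`: it is `u s` if `ℓ(u s) > ℓ(u)`, and `u`
otherwise. -/
def heckeSimple (u : P.weylGroup) (i : b.support) : P.weylGroup :=
  if length b u < length b (u * RootPairing.weylGroup.ofIdx P i) then
    u * RootPairing.weylGroup.ofIdx P i
  else u

/-- The Hecke product `u · v`: with any reduced word `s₁ ⋯ sᵣ` of `v`, it is
`(⋯((u · s₁) · s₂) ⋯) · sᵣ`. -/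
def heckeMul (u v : P.weylGroup) : P.weylGroup :=
  (Classical.epsilon fun l => IsReducedWord b l v).foldl (heckeSimple b) u

/-- The Weyl group `W_P` of the parabolic subgroup. -/
def parabolicWeyl (P : RootPairing ι ℝ M N) (J : Set ι) : Subgroup P.weylGroup :=
  Subgroup.closure (RootPairing.weylGroup.ofIdx P '' J)

/-- `w` is an element of maximal length of `W_P`. -/
def IsLongest (J : Set ι) (w : P.weylGroup) : Prop :=
  w ∈ parabolicWeyl P J ∧ ∀ v ∈ parabolicWeyl P J, length b v ≤ length b w

/-- The longest element `w_P` of `W_P`. -/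
def longest (J : Set ι) : P.weylGroup :=
  Classical.epsilon (IsLongest b J)

/-- The element `z_d^P`, determined by `z_d^P w_P = s_{α₁} · … · s_{αᵣ} · w_P` (Hecke product) for
any greedy decomposition `(α₁, …, αᵣ)` of the degree `d`. -/
def z (J : Set ι) (d : H2 P J) : P.weylGroup :=
  (Classical.epsilon fun l => IsGreedy b J l d).foldr
    (fun i w => heckeMul b (RootPairing.weylGroup.ofIdx P i) w) (longest b J) * (longest b J)⁻¹

/-! ### Minimal degrees, liftings, tangent directions -/

/-- `d` is a minimal degree: a minimal element of the set of all degrees `d'` such that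
`z_d^P ≤ z_{d'}^P` in the Bruhat order. -/
def IsMinimalDegree (J : Set ι) (d : H2 P J) : Prop :=
  IsDegree b J d ∧
    ∀ d', IsDegree b J d' → BruhatLE b (z b J d) (z b J d') → DegLE b J d' d → d' = d

/-- `e` is the lifting of `d`: the minimal degree in `H₂(G/B)` such that
`z_d^P w_P = z_e^B`. -/
def IsLifting (J : Set ι) (d : H2 P J) (e : H2 P (∅ : Set ι)) : Prop :=
  IsMinimalDegree b ∅ e ∧ z b J d * longest b J = z b ∅ e

/-- The generalized cascade of orthogonal roots `B_{R,e}`: the positive roots that occur in a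
greedy decomposition of `e`. -/
def cascade (e : H2 P (∅ : Set ι)) : Set ι :=
  {i | i ∈ posRoots P b.support ∧ ∃ l, IsGreedy b ∅ l e ∧ i ∈ l}

/-- The set of tangent directions `TD_{P,d}`, where `e` is the lifting of `d`: all
`-α - γ ∈ R⁻ ∖ R_P⁻` with `α ∈ B_{R,e} ∖ R_P⁺` and `γ ∈ R_P⁺ ∪ {0}`. -/
def tangentDirections (J : Set ι) (e : H2 P (∅ : Set ι)) : Set M :=
  {v | v ∈ -(P.root '' (posRoots P b.support \ posRoots P J)) ∧
    ∃ i ∈ cascade b e \ posRoots P J, ∃ c ∈ insert 0 (P.root '' posRoots P J),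
      v = -P.root i - c}

/-! ### Reduced words and longest elements exist, so the choices above are genuine -/

lemma finite_weylGroup [Finite ι] [P.IsRootSystem] : Finite P.weylGroup := by
  refine Finite.of_injective (fun g : P.weylGroup => RootPairing.Equiv.indexHom P g.1) ?_
  intro g h hgh
  apply Subtype.ext
  apply RootPairing.Equiv.weightHom_injective P
  apply LinearEquiv.toLinearMap_injective
  refine LinearMap.ext_on_range (v := P.root) RootPairing.IsRootSystem.span_root_eq_top ?_
  intro i
  have h1 := P.weylGroup_apply_root g i
  have h2 := P.weylGroup_apply_root h i
  have h3 : P.weylGroupToPerm g i = P.weylGroupToPerm h i := DFunLike.congr_fun hgh i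
  rw [h3, ← h2] at h1
  exact h1

lemma exists_isLongest [Finite ι] [P.IsRootSystem] (J : Set ι) : ∃ w, IsLongest b J w := by
  have := finite_weylGroup (P := P)
  obtain ⟨w, hw, h⟩ := Set.exists_max_image (parabolicWeyl P J : Set P.weylGroup) (length b)
    (Set.toFinite _) ⟨1, one_mem _⟩
  exact ⟨w, hw, h⟩

lemma exists_isReducedWord [Finite ι] [P.IsCrystallographic] [P.IsReduced] (w : P.weylGroup) :
    ∃ l, IsReducedWord b l w := by
  have ext' : ∀ {u v : P.weylGroup}, (∀ x : M, u • x = v • x) → u = v := fun h =>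
    Subtype.ext (RootPairing.Equiv.weightHom_injective P (LinearEquiv.ext h))
  have mul : ∀ u v : P.weylGroup, (∃ l, IsWord b l u) → (∃ l, IsWord b l v) →
      ∃ l, IsWord b l (u * v) := by
    rintro u v ⟨l, hl⟩ ⟨m, hm⟩
    exact ⟨l ++ m, by simp only [IsWord, List.map_append, List.prod_append] at *; rw [hl, hm]⟩
  have refl : ∀ i, ∃ l, IsWord b l (RootPairing.weylGroup.ofIdx P i) := by
    intro i
    refine b.induction_reflect (p := fun i => ∃ l, IsWord b l (RootPairing.weylGroup.ofIdx P i)) i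
      ?_ ?_ ?_
    · intro i h
      have : RootPairing.weylGroup.ofIdx P (P.reflectionPerm i i) =
          RootPairing.weylGroup.ofIdx P i := ext' fun x => by
        simp [RootPairing.reflection_reflectionPerm]
      rwa [this]
    · intro i hi
      exact ⟨[⟨i, hi⟩], by simp [IsWord]⟩
    · intro i j h hj
      have : RootPairing.weylGroup.ofIdx P (P.reflectionPerm j i) =
          RootPairing.weylGroup.ofIdx P j * RootPairing.weylGroup.ofIdx P i *
            RootPairing.weylGroup.ofIdx P j := ext' fun x => by
        simp [RootPairing.reflection_reflectionPerm, mul_smul]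
      have hj' : ∃ l, IsWord b l (RootPairing.weylGroup.ofIdx P j) :=
        ⟨[⟨j, hj⟩], by simp [IsWord]⟩
      rw [this]
      exact mul _ _ (mul _ _ hj' h) hj'
  have word : ∃ l, IsWord b l w := by
    obtain ⟨w, hw⟩ := w
    induction hw using RootPairing.weylGroup.induction with
    | mem i => exact refl i
    | one => exact ⟨[], rfl⟩
    | mul x y hx hy h1 h2 => exact mul _ _ h1 h2
  obtain ⟨l, hl⟩ := word
  obtain ⟨m, hm, hm'⟩ := Nat.sInf_mem
    (s := {n | ∃ l : List b.support, IsWord b l w ∧ l.length = n}) ⟨_, l, hl, rfl⟩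
  exact ⟨m, hm, hm'⟩

end

end FlagDegree

/-! Degrees on `G/B` are encoded by their coefficient vectors `c : b.support → ℕ`, and Weyl group
elements are multiplied in the Hecke monoid, in which `heckeRefl b a` is the reflection `s_a`.

The main input is a rigidity property of the greedy decompositions of the lifting `e`. Let `a` be a
maximal root of a degree `c`. It pairs nonnegatively with the support of `c - a^∨`
(`IsMaxRoot.pairing_nonneg`), so that `s_a` commutes with the simple reflections in that support
and absorbs those which are not orthogonal to `a`. The recursion `heckeDeg_eq_conj`,
`z_c = s_i · z_{c - i^∨} · s_i` if `⟨i, c⟩ > 0`, allows simple coroots to be split off from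
`c - a^∨` one at a time; those not orthogonal to `a` are absorbed by `s_a`. In the end `z_c` only
depends on `a` and on the part of `c - a^∨` that is supported on the simple roots orthogonal to `a`
(`heckeRefl_mul_heckeDeg`). If no smaller degree has the same Hecke product, as for the minimal
degree `e`, this part is all of `c - a^∨`, and the argument continues with `c - a^∨`. Hence, of any
two roots `a`, `a'` in the cascade, which does not depend on the choice of the greedy decomposition
(`GreedyList.unique`), the later one `a'` is supported on simple roots orthogonal to the earlier one
`a`; and `a + a'` is no root `j`, since otherwise `2 j^∨ = a^∨ + a'^∨` and `j` would contradict the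
maximality of `a`. This is the relation `CascadeRel`, from which it follows that `a - a'` is not a
root either.

Now let `a` and `a'` be two such roots outside `R_P⁺`, and let `g, g' ∈ R_P⁺`. If `(a, g) < 0`, then
`a + g` is a positive root outside `R_P⁺`, and it is not in the cascade, as `g` is not a difference
of two roots of the cascade. Suppose that also `(a', g') < 0`, and that `a + g = a' + g'`. If
`g - a'` were a root, it would be negative, since `a'` is not a sum of roots of `Δ_P`; then the
support of `g` would be contained in that of `a'`, which is orthogonal to `a`, against
`(a, g) < 0`. Hence `g - a' = g' - a` is not a root, so that `(g, a') ≤ 0` and `(g', a) ≤ 0`.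
Comparing pairings in `a + g = a' + g'` shows that `⟨g, a^∨⟩ ≤ -2`, hence `⟨a, g^∨⟩ = -1`, and then
`(g, g') > 0`. Thus `g' - g = a - a'` is a root, a contradiction
(`CascadeRel.false_of_add_eq_add`). -/

namespace FlagDegree

open RootPairing

variable {ι M N : Type*} [AddCommGroup M] [Module ℝ M] [AddCommGroup N] [Module ℝ N]
  {P : RootPairing ι ℝ M N}

section HeckeProduct

/-! ### Length and signs of roots -/

lemma weylGroup_ext {u v : P.weylGroup} (h : ∀ x : M, u • x = v • x) : u = v :=
  Subtype.ext (RootPairing.Equiv.weightHom_injective P (LinearEquiv.ext h))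

lemma ofIdx_mul_self (i : ι) : weylGroup.ofIdx P i * weylGroup.ofIdx P i = 1 :=
  weylGroup_ext fun x => by simp [mul_smul]

lemma ofIdx_inv (i : ι) : (weylGroup.ofIdx P i)⁻¹ = weylGroup.ofIdx P i :=
  inv_eq_of_mul_eq_one_left (ofIdx_mul_self i)

lemma toPerm_ofIdx (i j : ι) :
    P.weylGroupToPerm (weylGroup.ofIdx P i) j = P.reflectionPerm i j := rfl

lemma toPerm_mul (u v : P.weylGroup) (j : ι) :
    P.weylGroupToPerm (u * v) j = P.weylGroupToPerm u (P.weylGroupToPerm v j) := by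
  rw [map_mul]; rfl

lemma ofIdx_reflectionPerm (j i : ι) : weylGroup.ofIdx P (P.reflectionPerm j i) =
    weylGroup.ofIdx P j * weylGroup.ofIdx P i * weylGroup.ofIdx P j :=
  weylGroup_ext fun x => by simp [RootPairing.reflection_reflectionPerm, mul_smul]

lemma ofIdx_toPerm (u : P.weylGroup) (i : ι) :
    weylGroup.ofIdx P (P.weylGroupToPerm u i) = u * weylGroup.ofIdx P i * u⁻¹ := by
  obtain ⟨u, hu⟩ := u
  induction hu using RootPairing.weylGroup.induction generalizing i with
  | mem j =>
    change weylGroup.ofIdx P (P.reflectionPerm j i) =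
      weylGroup.ofIdx P j * weylGroup.ofIdx P i * (weylGroup.ofIdx P j)⁻¹
    rw [ofIdx_reflectionPerm, ofIdx_inv]
  | one =>
    change weylGroup.ofIdx P (P.weylGroupToPerm 1 i) = 1 * weylGroup.ofIdx P i * 1⁻¹
    simp
  | mul x y hx hy h1 h2 =>
    change weylGroup.ofIdx P (P.weylGroupToPerm (⟨x, hx⟩ * ⟨y, hy⟩) i) =
      ((⟨x, hx⟩ : P.weylGroup) * ⟨y, hy⟩) * weylGroup.ofIdx P i *
        ((⟨x, hx⟩ : P.weylGroup) * ⟨y, hy⟩)⁻¹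
    rw [toPerm_mul, h1, h2]
    group

variable (b : P.Base)

lemma isPos_reflectionPerm_self_iff (i : ι) :
    b.IsPos (P.reflectionPerm i i) ↔ ¬ b.IsPos i :=
  RootPairing.Base.IsPos.neg_iff_not b i

lemma toPerm_reflectionPerm_self (w : P.weylGroup) (k : ι) :
    P.weylGroupToPerm w (P.reflectionPerm k k) =
      P.reflectionPerm (P.weylGroupToPerm w k) (P.weylGroupToPerm w k) := by
  apply P.root.injective
  rw [← weylGroup_apply_root, P.root_reflectionPerm, P.root_reflectionPerm,
    P.reflection_apply_self, P.reflection_apply_self, smul_neg, weylGroup_apply_root]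

lemma reflectionPerm_reflectionPerm_self (k : ι) :
    P.reflectionPerm (P.reflectionPerm k k) (P.reflectionPerm k k) = k := by
  apply P.root.injective
  simp only [P.root_reflectionPerm, P.reflection_apply_self, RootPairing.reflection_reflectionPerm]
  simp

open Classical in
/-- The Hecke product of a simple reflection, on the left, with an element `w`. -/
noncomputable def simpleHecke (i : b.support) (w : P.weylGroup) : P.weylGroup :=
  if b.IsPos (P.weylGroupToPerm w⁻¹ i) then weylGroup.ofIdx P i * w else w

lemma simpleHecke_of_isPos {u : P.weylGroup} {i : b.support}
    (h : b.IsPos (P.weylGroupToPerm u⁻¹ i)) :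
    simpleHecke b i u = weylGroup.ofIdx P i * u :=
  if_pos h

lemma simpleHecke_of_not_isPos {u : P.weylGroup} {i : b.support}
    (h : ¬ b.IsPos (P.weylGroupToPerm u⁻¹ i)) : simpleHecke b i u = u :=
  if_neg h

variable [Finite ι] [P.IsCrystallographic] [P.IsReduced]

variable {b} in
/-- A simple reflection permutes the positive roots other than its own simple root. -/
lemma eq_of_not_isPos_reflectionPerm {i j : ι} (hj : j ∈ b.support) (hi : b.IsPos i)
    (h : ¬ b.IsPos (P.reflectionPerm j i)) : i = j := by
  by_contra hij
  exact h (hi.reflectionPerm hj hij)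

/-- The exchange condition. -/
lemma exists_isWord_mul {l : List b.support} {w : P.weylGroup} (hl : IsWord b l w)
    {j : ι} (hj : j ∈ b.support) (h : ¬ b.IsPos (P.weylGroupToPerm w j)) :
    ∃ l', IsWord b l' (w * weylGroup.ofIdx P j) ∧ l'.length + 1 = l.length := by
  induction l generalizing w with
  | nil =>
    obtain rfl : 1 = w := hl
    exact absurd (by simpa using RootPairing.Base.isPos_of_mem_support hj) h
  | cons i t ih =>
    obtain rfl : _ = w := hl
    simp only [List.map_cons, List.prod_cons] at h ⊢
    set u := (t.map fun i : b.support => weylGroup.ofIdx P i.1).prod with hu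
    by_cases hp : b.IsPos (P.weylGroupToPerm u j)
    · rw [toPerm_mul, toPerm_ofIdx] at h
      have he := eq_of_not_isPos_reflectionPerm i.2 hp h
      refine ⟨t, ?_, by simp⟩
      have := ofIdx_toPerm u j
      rw [he, eq_mul_inv_iff_mul_eq] at this
      change u = _
      rw [mul_assoc, ← this, ← mul_assoc, ofIdx_mul_self, one_mul]
    · obtain ⟨t', ht', hlen⟩ := ih (w := u) rfl hp
      refine ⟨i :: t', ?_, by simp [hlen]⟩
      simp only [IsWord, List.map_cons, List.prod_cons] at ht' ⊢
      rw [ht', mul_assoc]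

lemma length_mul_lt {w : P.weylGroup} {j : ι} (hj : j ∈ b.support)
    (h : ¬ b.IsPos (P.weylGroupToPerm w j)) :
    length b (w * weylGroup.ofIdx P j) < length b w := by
  obtain ⟨l, hl, hlen⟩ := exists_isReducedWord b w
  obtain ⟨l', hl', hlen'⟩ := exists_isWord_mul b hl hj h
  have : length b (w * weylGroup.ofIdx P j) ≤ l'.length := Nat.sInf_le ⟨l', hl', rfl⟩
  omega

lemma length_lt_mul_iff {w : P.weylGroup} {j : ι} (hj : j ∈ b.support) :
    length b w < length b (w * weylGroup.ofIdx P j) ↔ b.IsPos (P.weylGroupToPerm w j) := by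
  constructor
  · intro h
    by_contra hn
    exact absurd (length_mul_lt b hj hn) (by omega)
  · intro h
    have h2 : ¬ b.IsPos (P.weylGroupToPerm (w * weylGroup.ofIdx P j) j) := by
      rw [toPerm_mul, toPerm_ofIdx]
      intro hn
      have h3 : P.root (P.weylGroupToPerm w (P.reflectionPerm j j)) =
          P.root (P.reflectionPerm (P.weylGroupToPerm w j) (P.weylGroupToPerm w j)) := by
        rw [← weylGroup_apply_root, P.root_reflectionPerm, P.root_reflectionPerm,
          P.reflection_apply_self, P.reflection_apply_self, smul_neg, weylGroup_apply_root]
      rw [P.root.injective h3, isPos_reflectionPerm_self_iff] at hn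
      exact hn h
    simpa [mul_assoc, ofIdx_mul_self] using length_mul_lt b hj h2

/-! ### The Hecke product is associative -/

lemma heckeSimple_of_isPos {u : P.weylGroup} {i : b.support}
    (h : b.IsPos (P.weylGroupToPerm u i)) :
    heckeSimple b u i = u * weylGroup.ofIdx P i :=
  if_pos ((length_lt_mul_iff b i.2).2 h)

lemma heckeSimple_of_not_isPos {u : P.weylGroup} {i : b.support}
    (h : ¬ b.IsPos (P.weylGroupToPerm u i)) : heckeSimple b u i = u :=
  if_neg fun h' => h ((length_lt_mul_iff b i.2).1 h')

variable {b} in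
lemma isPos_reflectionPerm_iff {j k : ι} (hj : j ∈ b.support) (h1 : k ≠ j)
    (h2 : k ≠ P.reflectionPerm j j) : b.IsPos (P.reflectionPerm j k) ↔ b.IsPos k := by
  refine ⟨fun h => ?_, fun h => h.reflectionPerm hj h1⟩
  have := h.reflectionPerm hj fun e => h2 (by
    rw [← P.reflectionPerm_self j k, e])
  rwa [P.reflectionPerm_self] at this

/-- Left and right Hecke multiplication by simple reflections commute. -/
lemma heckeSimple_simpleHecke (i j : b.support) (w : P.weylGroup) :
    heckeSimple b (simpleHecke b i w) j = simpleHecke b i (heckeSimple b w j) := by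
  have key : ∀ k l : ι, P.weylGroupToPerm w⁻¹ k = l ↔ k = P.weylGroupToPerm w l := by
    intro k l
    rw [map_inv, Equiv.Perm.inv_eq_iff_eq]
  have neg := toPerm_reflectionPerm_self w
  have hi := RootPairing.Base.isPos_of_mem_support i.2
  have hj := RootPairing.Base.isPos_of_mem_support j.2
  have hi' : ¬ b.IsPos (P.reflectionPerm i i) := by
    rw [isPos_reflectionPerm_self_iff]; exact not_not.2 hi
  have hj' : ¬ b.IsPos (P.reflectionPerm j j) := by
    rw [isPos_reflectionPerm_self_iff]; exact not_not.2 hj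
  have e1 : P.weylGroupToPerm (weylGroup.ofIdx P (i : ι) * w) j =
      P.reflectionPerm i (P.weylGroupToPerm w j) := by
    rw [toPerm_mul, toPerm_ofIdx]
  have e2 : P.weylGroupToPerm (w * weylGroup.ofIdx P (j : ι))⁻¹ i =
      P.reflectionPerm j (P.weylGroupToPerm w⁻¹ i) := by
    rw [mul_inv_rev, ofIdx_inv, toPerm_mul, toPerm_ofIdx]
  by_cases h1 : P.weylGroupToPerm w j = i
  · have h1' : P.weylGroupToPerm w⁻¹ i = j := (key _ _).2 h1.symm
    have hc := ofIdx_toPerm w j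
    rw [h1, eq_mul_inv_iff_mul_eq] at hc
    rw [simpleHecke_of_isPos b (by rwa [h1']), heckeSimple_of_isPos b (u := w) (by rwa [h1]),
      heckeSimple_of_not_isPos b (by rwa [e1, h1]),
      simpleHecke_of_not_isPos b (by rwa [e2, h1']), hc]
  · by_cases h2 : P.weylGroupToPerm w j = P.reflectionPerm i i
    · have h2' : P.weylGroupToPerm w⁻¹ i = P.reflectionPerm j j := by
        rw [key, neg, h2, reflectionPerm_reflectionPerm_self]
      rw [simpleHecke_of_not_isPos b (by rwa [h2']), heckeSimple_of_not_isPos b (by rwa [h2]),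
        simpleHecke_of_not_isPos b (by rwa [h2'])]
    · have h1' : P.weylGroupToPerm w⁻¹ i ≠ j := fun h => h1 ((key _ _).1 h).symm
      have h2' : P.weylGroupToPerm w⁻¹ i ≠ P.reflectionPerm j j := by
        intro h
        rw [key, neg] at h
        apply h2
        rw [h, reflectionPerm_reflectionPerm_self]
      have f1 := isPos_reflectionPerm_iff i.2 h1 h2
      have f2 := isPos_reflectionPerm_iff j.2 h1' h2'
      rw [← e1] at f1
      rw [← e2] at f2
      by_cases hp : b.IsPos (P.weylGroupToPerm w j) <;>
        by_cases hq : b.IsPos (P.weylGroupToPerm w⁻¹ i)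
      · rw [simpleHecke_of_isPos b hq, heckeSimple_of_isPos b hp,
          heckeSimple_of_isPos b (f1.2 hp), simpleHecke_of_isPos b (f2.2 hq), mul_assoc]
      · rw [simpleHecke_of_not_isPos b hq, heckeSimple_of_isPos b hp,
          simpleHecke_of_not_isPos b (f2.not.2 hq)]
      · rw [simpleHecke_of_isPos b hq, heckeSimple_of_not_isPos b hp,
          heckeSimple_of_not_isPos b (f1.not.2 hp), simpleHecke_of_isPos b hq]
      · rw [simpleHecke_of_not_isPos b hq, heckeSimple_of_not_isPos b hp,
          simpleHecke_of_not_isPos b hq]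

variable {b} in
lemma IsReducedWord.foldl_eq {l : List b.support} {w : P.weylGroup} (h : IsReducedWord b l w) :
    l.foldl (heckeSimple b) 1 = w := by
  induction l using List.reverseRecOn generalizing w with
  | nil => exact h.1
  | append_singleton t j ih =>
    obtain ⟨h1, h2⟩ := h
    set u := (t.map fun i : b.support => weylGroup.ofIdx P i.1).prod with hu
    obtain rfl : u * weylGroup.ofIdx P j = w := by
      rw [← show _ = w from h1]; simp [hu]
    have le1 : length b u ≤ t.length := Nat.sInf_le ⟨t, rfl, rfl⟩
    have len : length b (u * weylGroup.ofIdx P j) ≤ length b u + 1 := by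
      obtain ⟨m, hm, hm'⟩ := exists_isReducedWord b u
      refine Nat.sInf_le ⟨m ++ [j], ?_, by simp [hm']⟩
      simp only [IsWord, List.map_append, List.prod_append] at hm ⊢
      rw [hm]; simp
    simp only [List.length_append, List.length_singleton] at h2
    rw [List.foldl_append, ih (w := u) ⟨rfl, by omega⟩]
    refine heckeSimple_of_isPos b ((length_lt_mul_iff b j.2).1 (by omega))

lemma foldr_simpleHecke_one (l : List b.support) :
    l.foldr (simpleHecke b) 1 = l.foldl (heckeSimple b) 1 := by
  have comm : ∀ (l : List b.support) (i : b.support) (w : P.weylGroup),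
      l.foldl (heckeSimple b) (simpleHecke b i w) =
        simpleHecke b i (l.foldl (heckeSimple b) w) := by
    intro l
    induction l with
    | nil => intros; rfl
    | cons j t ih =>
      intro i w
      rw [List.foldl_cons, heckeSimple_simpleHecke, ih, List.foldl_cons]
  induction l with
  | nil => rfl
  | cons i t ih =>
    have hi := RootPairing.Base.isPos_of_mem_support i.2
    rw [List.foldr_cons, ih, ← comm, List.foldl_cons, heckeSimple_of_isPos b (by simpa),
      simpleHecke_of_isPos b (by simpa), mul_one, one_mul]

lemma foldl_foldr_comm (l m : List b.support) (w : P.weylGroup) :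
    l.foldl (heckeSimple b) (m.foldr (simpleHecke b) w) =
      m.foldr (simpleHecke b) (l.foldl (heckeSimple b) w) := by
  have comm : ∀ (m : List b.support) (i : b.support) (w : P.weylGroup),
      heckeSimple b (m.foldr (simpleHecke b) w) i =
        m.foldr (simpleHecke b) (heckeSimple b w i) := by
    intro m
    induction m with
    | nil => intros; rfl
    | cons j t ih =>
      intro i w
      rw [List.foldr_cons, heckeSimple_simpleHecke, ih, List.foldr_cons]
  induction l generalizing w with
  | nil => rfl
  | cons i t ih => rw [List.foldl_cons, comm, ih, List.foldl_cons]

lemma exists_foldr_simpleHecke_eq (u : P.weylGroup) :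
    ∃ m : List b.support, m.foldr (simpleHecke b) 1 = u := by
  obtain ⟨l, hl⟩ := exists_isReducedWord b u
  exact ⟨l, by rw [foldr_simpleHecke_one, hl.foldl_eq]⟩

/-- The Hecke product can be computed from any expression of its left factor as a Hecke product
of simple reflections. -/
lemma heckeMul_eq_foldr {m : List b.support} {u : P.weylGroup}
    (hm : m.foldr (simpleHecke b) 1 = u) (v : P.weylGroup) :
    heckeMul b u v = m.foldr (simpleHecke b) v := by
  have hv : IsReducedWord b (Classical.epsilon fun l => IsReducedWord b l v) v :=
    Classical.epsilon_spec (exists_isReducedWord b v)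
  rw [heckeMul, ← hm, foldl_foldr_comm, hv.foldl_eq]

lemma one_heckeMul (v : P.weylGroup) : heckeMul b 1 v = v :=
  heckeMul_eq_foldr b (m := []) rfl v

lemma heckeMul_one (u : P.weylGroup) : heckeMul b u 1 = u := by
  obtain ⟨m, hm⟩ := exists_foldr_simpleHecke_eq b u
  rw [heckeMul_eq_foldr b hm, hm]

lemma heckeMul_assoc (u v w : P.weylGroup) :
    heckeMul b (heckeMul b u v) w = heckeMul b u (heckeMul b v w) := by
  obtain ⟨m, hm⟩ := exists_foldr_simpleHecke_eq b u
  obtain ⟨k, hk⟩ := exists_foldr_simpleHecke_eq b v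
  have : (m ++ k).foldr (simpleHecke b) 1 = heckeMul b u v := by
    rw [List.foldr_append, hk, heckeMul_eq_foldr b hm]
  rw [heckeMul_eq_foldr b this, heckeMul_eq_foldr b hm, heckeMul_eq_foldr b hk, List.foldr_append]

lemma heckeMul_ofIdx (u : P.weylGroup) (i : b.support) :
    heckeMul b u (weylGroup.ofIdx P i) = heckeSimple b u i := by
  obtain ⟨m, hm⟩ := exists_foldr_simpleHecke_eq b u
  have hi := RootPairing.Base.isPos_of_mem_support i.2
  have : weylGroup.ofIdx P (i : ι) = [i].foldl (heckeSimple b) 1 := by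
    rw [List.foldl_cons, heckeSimple_of_isPos b (by simpa), one_mul, List.foldl_nil]
  rw [heckeMul_eq_foldr b hm, this, ← foldl_foldr_comm, hm]
  rfl

lemma ofIdx_heckeMul (i : b.support) (v : P.weylGroup) :
    heckeMul b (weylGroup.ofIdx P i) v = simpleHecke b i v := by
  have hi := RootPairing.Base.isPos_of_mem_support i.2
  refine heckeMul_eq_foldr b (m := [i]) ?_ v
  rw [List.foldr_cons, List.foldr_nil, simpleHecke_of_isPos b (by simpa), mul_one]

/-- The Weyl group, regarded as a monoid under the Hecke product. -/
def HeckeMonoid (_b : P.Base) : Type _ := P.weylGroup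

noncomputable instance : Monoid (HeckeMonoid b) where
  mul := heckeMul b
  one := (1 : P.weylGroup)
  mul_assoc := heckeMul_assoc b
  one_mul := one_heckeMul b
  mul_one := heckeMul_one b

/-- The reflection in a root, as an element of the Hecke monoid. -/
def heckeRefl (i : ι) : HeckeMonoid b := weylGroup.ofIdx P i

lemma heckeRefl_mul_of_not_isPos {a : ι} {i : ι} (hi : i ∈ b.support)
    (h : ¬ b.IsPos (P.reflectionPerm a i)) :
    heckeRefl b a * heckeRefl b i = heckeRefl b a :=
  (heckeMul_ofIdx b (weylGroup.ofIdx P a) ⟨i, hi⟩).trans (heckeSimple_of_not_isPos b h)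

lemma mul_heckeRefl_of_not_isPos {a : ι} {i : ι} (hi : i ∈ b.support)
    (h : ¬ b.IsPos (P.reflectionPerm a i)) :
    heckeRefl b i * heckeRefl b a = heckeRefl b a :=
  (ofIdx_heckeMul b ⟨i, hi⟩ (weylGroup.ofIdx P a)).trans
    (simpleHecke_of_not_isPos b (by rwa [ofIdx_inv, toPerm_ofIdx]))

lemma heckeRefl_mul_self {i : ι} (hi : i ∈ b.support) :
    heckeRefl b i * heckeRefl b i = heckeRefl b i :=
  heckeRefl_mul_of_not_isPos b hi (by
    rw [isPos_reflectionPerm_self_iff]; exact not_not.2 (RootPairing.Base.isPos_of_mem_support hi))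

/-- A reflection whose root is orthogonal to a simple root commutes with the simple reflection. -/
lemma commute_heckeRefl_of_pairing_eq_zero {a : ι} {i : ι} (hi : i ∈ b.support)
    (h : P.pairing i a = 0) : Commute (heckeRefl b a) (heckeRefl b i) := by
  have h1 : P.reflectionPerm a i = i := by
    apply P.root.injective
    rw [P.root_reflectionPerm, P.reflection_apply_root, h, zero_smul, sub_zero]
  have hpos := RootPairing.Base.isPos_of_mem_support hi
  have e1 : heckeRefl b a * heckeRefl b i = (weylGroup.ofIdx P a * weylGroup.ofIdx P i :) :=
    (heckeMul_ofIdx b (weylGroup.ofIdx P a) ⟨i, hi⟩).trans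
      (heckeSimple_of_isPos b (by rwa [toPerm_ofIdx, h1]))
  have e2 : heckeRefl b i * heckeRefl b a = (weylGroup.ofIdx P i * weylGroup.ofIdx P a :) :=
    (ofIdx_heckeMul b ⟨i, hi⟩ (weylGroup.ofIdx P a)).trans
      (simpleHecke_of_isPos b (by rwa [ofIdx_inv, toPerm_ofIdx, h1]))
  rw [Commute, SemiconjBy, e1, e2]
  have := ofIdx_toPerm (weylGroup.ofIdx P a) i
  rw [toPerm_ofIdx, h1, eq_mul_inv_iff_mul_eq] at this
  exact this.symm

/-- Hecke conjugation by a simple reflection agrees with conjugation if it makes the element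
longer on both sides. -/
lemma heckeRefl_conj {a : ι} {i : ι} (hi : i ∈ b.support)
    (h1 : b.IsPos (P.reflectionPerm a i))
    (h2 : b.IsPos (P.reflectionPerm i (P.reflectionPerm a i))) :
    heckeRefl b i * heckeRefl b a * heckeRefl b i = heckeRefl b (P.reflectionPerm i a) := by
  have e1 : heckeRefl b a * heckeRefl b i = (weylGroup.ofIdx P a * weylGroup.ofIdx P i :) :=
    (heckeMul_ofIdx b (weylGroup.ofIdx P a) ⟨i, hi⟩).trans
      (heckeSimple_of_isPos b (by rwa [toPerm_ofIdx]))
  have e2 : heckeRefl b i * (heckeRefl b a * heckeRefl b i) =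
      (weylGroup.ofIdx P i * (weylGroup.ofIdx P a * weylGroup.ofIdx P i) :) := by
    rw [e1]
    exact (ofIdx_heckeMul b ⟨i, hi⟩ _).trans (simpleHecke_of_isPos b (by
      rwa [mul_inv_rev, ofIdx_inv, ofIdx_inv, toPerm_mul, toPerm_ofIdx, toPerm_ofIdx]))
  rw [mul_assoc, e2, ← mul_assoc]
  exact (ofIdx_reflectionPerm i a).symm

end HeckeProduct

section Coefficients

variable (b : P.Base)

/-! ### Coefficients of roots and coroots -/

lemma exists_root_eq_sum (i : ι) :
    ∃ f : b.support → ℤ, P.root i = ∑ k : b.support, f k • P.root k := by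
  obtain ⟨f, -, -, hf⟩ := b.exists_root_eq_sum_int i
  exact ⟨fun k => f k, by rw [hf, ← Finset.sum_coe_sort b.support fun k => f k • P.root k]⟩

/-- The coefficients of a root with respect to the simple roots. -/
noncomputable def rootCoeff (i : ι) : b.support → ℤ := (exists_root_eq_sum b i).choose

lemma root_eq_sum (i : ι) : P.root i = ∑ k : b.support, rootCoeff b i k • P.root k :=
  (exists_root_eq_sum b i).choose_spec

lemma exists_coroot_eq_sum (i : ι) :
    ∃ f : b.support → ℤ, P.coroot i = ∑ k : b.support, f k • P.coroot k :=
  exists_root_eq_sum b.flip i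

/-- The coefficients of a coroot with respect to the simple coroots. -/
noncomputable def corootCoeff (i : ι) : b.support → ℤ := (exists_coroot_eq_sum b i).choose

lemma coroot_eq_sum (i : ι) : P.coroot i = ∑ k : b.support, corootCoeff b i k • P.coroot k :=
  (exists_coroot_eq_sum b i).choose_spec

variable {b}

lemma eq_of_sum_root_eq {f g : b.support → ℤ}
    (h : ∑ k : b.support, f k • P.root k = ∑ k : b.support, g k • P.root k) : f = g :=
  funext fun k => Fintype.linearIndependent_iffₛ.mp
    (b.linearIndepOn_root.restrict_scalars' ℤ) f g h k

lemma eq_of_sum_coroot_eq {f g : b.support → ℤ}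
    (h : ∑ k : b.support, f k • P.coroot k = ∑ k : b.support, g k • P.coroot k) : f = g :=
  funext fun k => Fintype.linearIndependent_iffₛ.mp
    (b.linearIndepOn_coroot.restrict_scalars' ℤ) f g h k

lemma rootCoeff_eq_of_root_eq {i j k : ι} {x y : ℤ}
    (h : P.root k = x • P.root i + y • P.root j) :
    rootCoeff b k = x • rootCoeff b i + y • rootCoeff b j := by
  apply eq_of_sum_root_eq
  rw [← root_eq_sum, h]
  nth_rw 1 [root_eq_sum b i, root_eq_sum b j]
  simp [add_smul, mul_smul, Finset.sum_add_distrib, Finset.smul_sum]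

lemma corootCoeff_eq_of_coroot_eq {i j k : ι} {x y : ℤ}
    (h : P.coroot k = x • P.coroot i + y • P.coroot j) :
    corootCoeff b k = x • corootCoeff b i + y • corootCoeff b j := by
  apply eq_of_sum_coroot_eq
  rw [← coroot_eq_sum, h]
  nth_rw 1 [coroot_eq_sum b i, coroot_eq_sum b j]
  simp [add_smul, mul_smul, Finset.sum_add_distrib, Finset.smul_sum]

open Classical in
lemma rootCoeff_simple (i : b.support) : rootCoeff b i = Pi.single i 1 := by
  apply eq_of_sum_root_eq
  rw [← root_eq_sum, Finset.sum_eq_single i (by simp +contextual) (by simp)]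
  simp

open Classical in
lemma corootCoeff_simple (i : b.support) : corootCoeff b i = Pi.single i 1 := by
  apply eq_of_sum_coroot_eq
  rw [← coroot_eq_sum, Finset.sum_eq_single i (by simp +contextual) (by simp)]
  simp

lemma rootCoeff_injective {i j : ι} (h : rootCoeff b i = rootCoeff b j) : i = j :=
  P.root.injective (by rw [root_eq_sum b i, root_eq_sum b j, h])

lemma rootCoeff_reflectionPerm_self (i : ι) :
    rootCoeff b (P.reflectionPerm i i) = - rootCoeff b i := by
  have : P.root (P.reflectionPerm i i) = (-1 : ℤ) • P.root i + (0 : ℤ) • P.root i := by simp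
  rw [rootCoeff_eq_of_root_eq this]; simp

lemma corootCoeff_reflectionPerm_self (i : ι) :
    corootCoeff b (P.reflectionPerm i i) = - corootCoeff b i := by
  have : P.coroot (P.reflectionPerm i i) = (-1 : ℤ) • P.coroot i + (0 : ℤ) • P.coroot i := by simp
  rw [corootCoeff_eq_of_coroot_eq this]; simp

/-- Sums of simple roots are characterised by their coefficients. -/
lemma sum_mem_closure_iff (J : Set ι) (hJ : J ⊆ b.support) (f : b.support → ℤ) :
    ∑ k : b.support, f k • P.root k ∈ AddSubmonoid.closure (P.root '' J) ↔
      0 ≤ f ∧ ∀ k : b.support, f k ≠ 0 → (k : ι) ∈ J := by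
  constructor
  · intro h
    obtain ⟨g, hg, h1, h2⟩ : ∃ g : b.support → ℤ,
        ∑ k : b.support, f k • P.root k = ∑ k : b.support, g k • P.root k ∧
        0 ≤ g ∧ ∀ k : b.support, g k ≠ 0 → (k : ι) ∈ J := by
      generalize ∑ k : b.support, f k • P.root k = x at h
      induction h using AddSubmonoid.closure_induction with
      | mem x hx =>
        classical
        obtain ⟨j, hj, rfl⟩ := hx
        refine ⟨Pi.single ⟨j, hJ hj⟩ 1, ?_, ?_, ?_⟩
        · rw [Finset.sum_eq_single ⟨j, hJ hj⟩ (by simp +contextual) (by simp)]; simp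
        · exact Pi.single_nonneg.2 zero_le_one
        · intro k hk
          obtain rfl : k = ⟨j, hJ hj⟩ := by
            by_contra h; exact hk (by simp [h])
          exact hj
      | zero => exact ⟨0, by simp, le_rfl, by simp⟩
      | add x y _ _ hx hy =>
        obtain ⟨g, rfl, h1, h2⟩ := hx
        obtain ⟨g', rfl, h1', h2'⟩ := hy
        refine ⟨g + g', by simp [add_smul, Finset.sum_add_distrib], add_nonneg h1 h1', ?_⟩
        intro k hk
        by_cases h : g k = 0
        · exact h2' k fun h' => hk (by simp [h, h'])
        · exact h2 k h
    rw [eq_of_sum_root_eq hg]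
    exact ⟨h1, h2⟩
  · rintro ⟨h1, h2⟩
    refine sum_mem fun k _ => ?_
    by_cases hk : f k = 0
    · simp [hk]
    · obtain ⟨n, hn⟩ := Int.eq_ofNat_of_zero_le (h1 k)
      rw [hn, natCast_zsmul]
      exact nsmul_mem (AddSubmonoid.subset_closure (Set.mem_image_of_mem _ (h2 k hk))) n

lemma rootLE_iff {i j : ι} : RootLE b i j ↔ rootCoeff b i ≤ rootCoeff b j := by
  rw [RootLE, ← sub_nonneg (b := rootCoeff b i), root_eq_sum b i, root_eq_sum b j,
    ← Finset.sum_sub_distrib]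
  simp_rw [← sub_smul]
  rw [show (∑ x : b.support, (rootCoeff b j x - rootCoeff b i x) • P.root x) =
    ∑ x : b.support, (rootCoeff b j - rootCoeff b i) x • P.root x from rfl,
    sum_mem_closure_iff _ subset_rfl]
  simp

lemma rootCoeff_nonneg_or_nonpos (i : ι) : 0 ≤ rootCoeff b i ∨ rootCoeff b i ≤ 0 := by
  rcases b.root_mem_or_neg_mem i with h | h
  · rw [root_eq_sum b i, sum_mem_closure_iff _ subset_rfl] at h
    exact Or.inl h.1
  · rw [show -P.root i = P.root (P.reflectionPerm i i) by simp, root_eq_sum b _,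
      sum_mem_closure_iff _ subset_rfl, rootCoeff_reflectionPerm_self] at h
    exact Or.inr (neg_nonneg.1 h.1)

lemma height_eq (i : ι) : b.height i = ∑ k, rootCoeff b i k := by
  classical
  let f : ι → ℤ := fun k => if h : k ∈ b.support then rootCoeff b i ⟨k, h⟩ else 0
  have h : P.root i = ∑ k ∈ b.support, f k • P.root k := by
    rw [root_eq_sum b i, ← Finset.sum_coe_sort b.support fun k => f k • P.root k]
    exact Finset.sum_congr rfl fun k _ => by simp [f]
  rw [Base.height_eq_sum h, ← Finset.sum_coe_sort b.support]
  exact Finset.sum_congr rfl fun k _ => by simp [f]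

lemma rootCoeff_nonneg {i : ι} (h : b.IsPos i) : 0 ≤ rootCoeff b i := by
  refine (rootCoeff_nonneg_or_nonpos i).resolve_right fun h' => ?_
  rw [Base.isPos_iff, height_eq] at h
  exact absurd (Finset.sum_nonpos fun k _ => h' k) (not_le.2 h)

lemma isPos_of_rootCoeff_pos {i : ι} {k : b.support} (h : 0 < rootCoeff b i k) : b.IsPos i := by
  have h' := (rootCoeff_nonneg_or_nonpos (b := b) i).resolve_right fun h' => by
    have := h' k; simp only [Pi.zero_apply] at this; omega
  rw [Base.isPos_iff', height_eq]
  exact Finset.sum_nonneg fun k _ => h' k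

lemma exists_rootCoeff_pos {i : ι} (h : b.IsPos i) : ∃ k, 0 < rootCoeff b i k := by
  rw [Base.isPos_iff, height_eq] at h
  obtain ⟨k, -, hk⟩ := Finset.exists_lt_of_sum_lt (s := Finset.univ)
    (f := fun _ : b.support => (0 : ℤ)) (g := rootCoeff b i) (by simpa using h)
  exact ⟨k, hk⟩

lemma mem_posRoots_iff {J : Set ι} (hJ : J ⊆ b.support) {i : ι} :
    i ∈ posRoots P J ↔ b.IsPos i ∧ ∀ k : b.support, rootCoeff b i k ≠ 0 → (k : ι) ∈ J := by
  change P.root i ∈ AddSubmonoid.closure (P.root '' J) ↔ _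
  rw [root_eq_sum b i, sum_mem_closure_iff J hJ]
  refine and_congr_left fun _ => ⟨fun h => ?_, rootCoeff_nonneg⟩
  rw [Base.isPos_iff', height_eq]
  exact Finset.sum_nonneg fun k _ => h k

lemma mem_posRoots_support_iff {i : ι} : i ∈ posRoots P b.support ↔ b.IsPos i := by
  rw [mem_posRoots_iff subset_rfl]
  simp

/-! ### The invariant form -/

variable (B : P.InvariantForm)

lemma toLinearMap_coroot_mul (y : M) (i : ι) :
    P.toLinearMap y (P.coroot i) * B.form (P.root i) (P.root i) = 2 * B.form y (P.root i) := by
  have h := B.apply_reflection_reflection i y (P.root i)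
  rw [P.reflection_apply_self, P.reflection_apply] at h
  simp only [map_sub, map_neg, map_smul, LinearMap.sub_apply, LinearMap.smul_apply,
    smul_eq_mul] at h
  have : P.coroot' i y = P.toLinearMap y (P.coroot i) := rfl
  rw [← this]
  linarith

lemma form_comm (x y : M) : B.form x y = B.form y x := by
  simpa using B.symm.eq x y

/-- The element of `M` which corresponds to a combination of simple coroots. -/
noncomputable def corootVec (f : b.support → ℤ) : M :=
  ∑ k : b.support, (f k * (2 / B.form (P.root k) (P.root k))) • P.root k

variable {B} (hB : ∀ x : M, x ≠ 0 → 0 < B.form x x)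
include hB

lemma form_root_pos (i : ι) : 0 < B.form (P.root i) (P.root i) := hB _ (P.ne_zero i)

lemma form_corootVec (f : b.support → ℤ) (y : M) :
    B.form (corootVec B f) y = ∑ k : b.support, f k * P.toLinearMap y (P.coroot k) := by
  rw [corootVec, map_sum, LinearMap.sum_apply]
  refine Finset.sum_congr rfl fun k _ => ?_
  have h := toLinearMap_coroot_mul B y k
  have h2 := form_root_pos hB (k : ι)
  rw [map_smul, LinearMap.smul_apply, smul_eq_mul, form_comm B (P.root k) y, mul_assoc]
  congr 1
  field_simp
  linarith

lemma corootVec_corootCoeff (i : ι) :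
    corootVec B (corootCoeff b i) = (2 / B.form (P.root i) (P.root i)) • P.root i := by
  rw [← sub_eq_zero]
  by_contra hne
  have key : ∀ y, B.form (corootVec B (corootCoeff b i) -
      (2 / B.form (P.root i) (P.root i)) • P.root i) y = 0 := by
    intro y
    have h := toLinearMap_coroot_mul B y i
    have h2 := form_root_pos hB i
    rw [map_sub, LinearMap.sub_apply, form_corootVec hB, map_smul, LinearMap.smul_apply,
      smul_eq_mul, form_comm B (P.root i) y]
    have : P.toLinearMap y (P.coroot i) =
        ∑ k : b.support, corootCoeff b i k * P.toLinearMap y (P.coroot k) := by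
      rw [coroot_eq_sum b i, map_sum]
      simp
    rw [← this]
    field_simp
    linarith
  exact (hB _ hne).ne' (key _)

/-- The coefficients of a root and of its coroot are proportional, up to root lengths. -/
lemma corootCoeff_mul_form (i : ι) (k : b.support) :
    corootCoeff b i k * B.form (P.root i) (P.root i) =
      rootCoeff b i k * B.form (P.root k) (P.root k) := by
  have h := corootVec_corootCoeff (b := b) hB i
  rw [root_eq_sum b i, Finset.smul_sum, corootVec] at h
  have h' : ∑ k : b.support, (corootCoeff b i k * (2 / B.form (P.root k) (P.root k))) • P.root k =
      ∑ k : b.support, (2 / B.form (P.root i) (P.root i) * rootCoeff b i k) • P.root k := by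
    rw [h]
    refine Finset.sum_congr rfl fun k _ => ?_
    rw [← root_eq_sum b i, mul_smul, Int.cast_smul_eq_zsmul]
  have := Fintype.linearIndependent_iffₛ.mp b.linearIndepOn_root _ _ h' k
  have h1 := form_root_pos hB i
  have h2 := form_root_pos hB (k : ι)
  field_simp at this
  linarith

lemma corootCoeff_pos_iff {i : ι} {k : b.support} :
    0 < corootCoeff b i k ↔ 0 < rootCoeff b i k := by
  have h := corootCoeff_mul_form (b := b) hB i k
  have h1 := form_root_pos hB i
  have h2 := form_root_pos hB (k : ι)
  rw [← Int.cast_pos (R := ℝ), ← Int.cast_pos (R := ℝ), ← mul_pos_iff_of_pos_right h1, h,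
    mul_pos_iff_of_pos_right h2]

lemma corootCoeff_nonneg {i : ι} (hi : b.IsPos i) : 0 ≤ corootCoeff b i := by
  intro k
  have h := corootCoeff_mul_form (b := b) hB i k
  have h1 := form_root_pos hB i
  have h2 := form_root_pos hB (k : ι)
  have h3 : (0 : ℝ) ≤ rootCoeff b i k := Int.cast_nonneg (rootCoeff_nonneg hi k)
  rw [Pi.zero_apply, ← Int.cast_nonneg_iff (R := ℝ)]
  by_contra hneg
  nlinarith

end Coefficients

section MaximalRoots

variable (b : P.Base)

/-! ### Degrees as coefficient vectors, and their maximal roots -/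

/-- The coefficients of the coroot of a positive root, as natural numbers (for a negative root,
all of them are `0`). -/
noncomputable def cor (i : ι) : b.support → ℕ := fun k => (corootCoeff b i k).toNat

/-- A maximal root of the degree with coefficients `c`. -/
def IsMaxRoot (c : b.support → ℕ) (i : ι) : Prop :=
  b.IsPos i ∧ cor b i ≤ c ∧
    ∀ j, b.IsPos j → cor b j ≤ c → rootCoeff b i ≤ rootCoeff b j → j = i

/-- The pairing of the root `i` with the degree with coefficients `c`. -/
noncomputable def degPairing [P.IsCrystallographic] (c : b.support → ℕ) (i : ι) : ℤ :=
  ∑ k : b.support, c k * P.pairingIn ℤ i k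

variable {b} {B : P.InvariantForm} (hB : ∀ x : M, x ≠ 0 → 0 < B.form x x)

lemma form_corootVec_corootVec (f g : b.support → ℤ) :
    B.form (corootVec B f) (corootVec B g) = ∑ l : b.support,
      g l * (2 / B.form (P.root l) (P.root l)) * B.form (corootVec B f) (P.root l) := by
  nth_rw 2 [corootVec]
  rw [map_sum]
  exact Finset.sum_congr rfl fun l _ => by rw [map_smul, smul_eq_mul]

section Form

include hB

lemma cast_cor {i : ι} (hi : b.IsPos i) (k : b.support) : (cor b i k : ℤ) = corootCoeff b i k :=
  Int.toNat_of_nonneg (corootCoeff_nonneg hB hi k)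

lemma cor_pos_iff {i : ι} {k : b.support} : 0 < cor b i k ↔ 0 < rootCoeff b i k := by
  rw [← corootCoeff_pos_iff hB, cor, Int.lt_toNat, Nat.cast_zero]

lemma form_corootVec_nonneg {f g : b.support → ℤ} (hg : 0 ≤ g)
    (h : ∀ l : b.support, 0 < g l → 0 ≤ B.form (corootVec B f) (P.root l)) :
    0 ≤ B.form (corootVec B f) (corootVec B g) := by
  rw [form_corootVec_corootVec]
  refine Finset.sum_nonneg fun l _ => ?_
  rcases (show 0 ≤ g l from hg l).eq_or_lt with h0 | h0
  · simp [← h0]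
  · have := form_root_pos hB (l : ι)
    exact mul_nonneg (mul_nonneg (by exact_mod_cast h0.le) (by positivity)) (h l h0)

lemma form_corootVec_nonpos {f g : b.support → ℤ} (hg : 0 ≤ g)
    (h : ∀ l : b.support, 0 < g l → B.form (corootVec B f) (P.root l) ≤ 0) :
    B.form (corootVec B f) (corootVec B g) ≤ 0 := by
  rw [form_corootVec_corootVec]
  refine Finset.sum_nonpos fun l _ => ?_
  rcases (show 0 ≤ g l from hg l).eq_or_lt with h0 | h0
  · simp [← h0]
  · have := form_root_pos hB (l : ι)
    exact mul_nonpos_of_nonneg_of_nonpos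
      (mul_nonneg (by exact_mod_cast h0.le) (by positivity)) (h l h0)

lemma eq_zero_of_corootVec_eq_zero {f : b.support → ℤ} (h : corootVec B f = 0) : f = 0 := by
  funext k
  have := Fintype.linearIndependent_iff.mp b.linearIndepOn_root _ h k
  have h2 := form_root_pos hB (k : ι)
  have h3 : (2 / B.form (P.root k) (P.root k)) ≠ 0 := by positivity
  simpa [h3, h2.ne'] using this

end Form

lemma corootVec_add (f g : b.support → ℤ) :
    corootVec B (f + g) = corootVec B f + corootVec B g := by
  simp [corootVec, add_mul, add_smul, Finset.sum_add_distrib]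

lemma exists_isMaxRoot_ge [Finite ι] {c : b.support → ℕ} {i : ι} (hi : b.IsPos i)
    (hc : cor b i ≤ c) : ∃ j, IsMaxRoot b c j ∧ rootCoeff b i ≤ rootCoeff b j := by
  obtain ⟨j, ⟨h1, h2, h3⟩, hmax⟩ := Set.exists_max_image
    {j | b.IsPos j ∧ cor b j ≤ c ∧ rootCoeff b i ≤ rootCoeff b j} b.height (Set.toFinite _)
    ⟨i, hi, hc, le_rfl⟩
  refine ⟨j, ⟨h1, h2, fun k hk1 hk2 hk3 => rootCoeff_injective (b := b) ?_⟩, h3⟩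
  have := hmax k ⟨hk1, hk2, h3.trans hk3⟩
  rw [height_eq, height_eq] at this
  have he := (Finset.sum_eq_sum_iff_of_le fun l _ => hk3 l).1
    (le_antisymm (Finset.sum_le_sum fun l _ => hk3 l) this)
  exact funext fun l => (he l (Finset.mem_univ _)).symm

section Pairing

variable [P.IsCrystallographic]

lemma cast_pairingIn (i j : ι) : (P.pairingIn ℤ i j : ℝ) = P.pairing i j := by
  simpa using P.algebraMap_pairingIn ℤ i j

lemma rootCoeff_reflectionPerm (i j : ι) :
    rootCoeff b (P.reflectionPerm j i) = rootCoeff b i - P.pairingIn ℤ i j • rootCoeff b j := by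
  have : P.root (P.reflectionPerm j i) = (1 : ℤ) • P.root i + (-P.pairingIn ℤ i j) • P.root j := by
    rw [P.root_reflectionPerm, P.reflection_apply_root, ← cast_pairingIn, Int.cast_smul_eq_zsmul]
    simp [sub_eq_add_neg]
  rw [rootCoeff_eq_of_root_eq this]
  simp [sub_eq_add_neg]

lemma corootCoeff_reflectionPerm (i j : ι) :
    corootCoeff b (P.reflectionPerm j i) =
      corootCoeff b i - P.pairingIn ℤ j i • corootCoeff b j := by
  have : P.coroot (P.reflectionPerm j i) =
      (1 : ℤ) • P.coroot i + (-P.pairingIn ℤ j i) • P.coroot j := by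
    rw [P.coroot_reflectionPerm, P.coreflection_apply_coroot, ← cast_pairingIn,
      Int.cast_smul_eq_zsmul]
    simp [sub_eq_add_neg]
  rw [corootCoeff_eq_of_coroot_eq this]
  simp [sub_eq_add_neg]

lemma degPairing_add (c c' : b.support → ℕ) (i : ι) :
    degPairing b (c + c') i = degPairing b c i + degPairing b c' i := by
  simp [degPairing, add_mul, Finset.sum_add_distrib]

lemma degPairing_sub {c c' : b.support → ℕ} (h : c' ≤ c) (i : ι) :
    degPairing b (c - c') i = degPairing b c i - degPairing b c' i := by
  have := degPairing_add (c - c') c' i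
  rw [tsub_add_cancel_of_le h] at this
  omega

include hB in
lemma form_corootVec_degree (c : b.support → ℕ) (i : ι) :
    B.form (corootVec B fun k => (c k : ℤ)) (P.root i) = degPairing b c i := by
  rw [form_corootVec hB, degPairing]
  push_cast
  refine Finset.sum_congr rfl fun k _ => ?_
  rw [cast_pairingIn, root_coroot_eq_pairing]

include hB in
lemma degPairing_cor {i : ι} (hi : b.IsPos i) (j : ι) :
    degPairing b (cor b i) j = P.pairingIn ℤ j i := by
  rw [← Int.cast_inj (α := ℝ), ← form_corootVec_degree hB]
  simp_rw [cast_cor hB hi]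
  rw [corootVec_corootCoeff hB, map_smul, LinearMap.smul_apply, smul_eq_mul, cast_pairingIn]
  have h1 := toLinearMap_coroot_mul B (P.root j) i
  have h2 := form_root_pos hB i
  rw [root_coroot_eq_pairing] at h1
  rw [form_comm B (P.root j)] at h1
  field_simp
  linarith

include hB in
lemma exists_degPairing_pos {c : b.support → ℕ} (hc : c ≠ 0) :
    ∃ k : b.support, 0 < degPairing b c k := by
  by_contra! h
  have h1 : corootVec B (fun k => (c k : ℤ)) ≠ 0 := fun h0 => hc (by
    have := eq_zero_of_corootVec_eq_zero hB h0
    funext k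
    simpa using congrFun this k)
  refine absurd (form_corootVec_nonpos hB (f := fun k => (c k : ℤ)) (g := fun k => (c k : ℤ))
    (fun k => by simp) fun l _ => ?_) (not_le.2 (hB _ h1))
  rw [form_corootVec_degree hB]
  exact_mod_cast h l

variable [Finite ι]

lemma pos_of_degPairing_pos {c : b.support → ℕ} {k : b.support} (h : 0 < degPairing b c k) :
    0 < c k := by
  rw [Nat.pos_iff_ne_zero]
  intro h0
  refine absurd (Finset.sum_nonpos fun l _ => ?_) (not_le.2 h)
  rcases eq_or_ne k l with rfl | hkl
  · simp [h0]
  · exact mul_nonpos_of_nonneg_of_nonpos (by simp)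
      (b.pairingIn_le_zero_of_ne (fun h => hkl (Subtype.ext h)) k.2 l.2)

variable [P.IsReduced]

lemma pairing_eq_neg_one_or {i j : ι} (hi : b.IsPos i) (hj : b.IsPos j)
    (h : P.pairingIn ℤ i j < 0) : P.pairingIn ℤ i j = -1 ∨ P.pairingIn ℤ j i = -1 := by
  have h2 : P.root i ≠ - P.root j := by
    intro h'
    rw [P.root_eq_neg_iff] at h'
    rw [h', isPos_reflectionPerm_self_iff] at hi
    exact hi hj
  have h1 : P.root i ≠ P.root j := by
    intro h'
    rw [P.root.injective h', P.pairingIn_same] at h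
    omega
  have := P.pairingIn_pairingIn_mem_set_of_isCrystal_of_isRed' _ _ h1 h2
  simp only [Set.mem_insert_iff, Set.mem_singleton_iff, Prod.mk.injEq] at this
  omega

lemma pairing_eq_one_or {i j : ι} (hij : i ≠ j) (hi : b.IsPos i) (hj : b.IsPos j)
    (h : 0 < P.pairingIn ℤ i j) : P.pairingIn ℤ i j = 1 ∨ P.pairingIn ℤ j i = 1 := by
  have h2 : P.root i ≠ - P.root j := by
    intro h'
    rw [P.root_eq_neg_iff] at h'
    rw [h', isPos_reflectionPerm_self_iff] at hi
    exact hi hj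
  have := P.pairingIn_pairingIn_mem_set_of_isCrystal_of_isRed' _ _ (P.root.injective.ne hij) h2
  simp only [Set.mem_insert_iff, Set.mem_singleton_iff, Prod.mk.injEq] at this
  omega

include hB in
/-- A maximal root of a degree pairs nonnegatively with the support of the remaining degree:
otherwise `s_k α` or `s_α k` is a larger root whose coroot is `α^∨ + k^∨`. -/
lemma IsMaxRoot.pairing_nonneg {c : b.support → ℕ} {i : ι} (h : IsMaxRoot b c i)
    {k : b.support} (hk : cor b i k < c k) : 0 ≤ P.pairingIn ℤ i k := by
  classical
  by_contra! hneg
  have hneg' : P.pairingIn ℤ k i < 0 := (P.pairingIn_lt_zero_iff ℤ).1 hneg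
  have hkp := RootPairing.Base.isPos_of_mem_support k.2
  obtain ⟨j, hj1, hj2⟩ : ∃ j, corootCoeff b j = corootCoeff b i + corootCoeff b k ∧
      rootCoeff b i ≤ rootCoeff b j := by
    rcases pairing_eq_neg_one_or h.1 hkp hneg with h1 | h1
    · refine ⟨P.reflectionPerm i k, ?_, ?_⟩
      · rw [corootCoeff_reflectionPerm, h1]
        simp [add_comm]
      · rw [rootCoeff_reflectionPerm]
        intro l
        have e1 := rootCoeff_nonneg hkp l
        have e2 := rootCoeff_nonneg h.1 l
        simp only [Pi.zero_apply, Pi.sub_apply, Pi.smul_apply, smul_eq_mul] at e1 e2 ⊢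
        nlinarith
    · refine ⟨P.reflectionPerm k i, ?_, ?_⟩
      · rw [corootCoeff_reflectionPerm, h1]
        simp
      · rw [rootCoeff_reflectionPerm]
        intro l
        have e1 := rootCoeff_nonneg hkp l
        simp only [Pi.zero_apply, Pi.sub_apply, Pi.smul_apply, smul_eq_mul] at e1 ⊢
        nlinarith
  have hjpos : b.IsPos j := by
    obtain ⟨l, hl⟩ := exists_rootCoeff_pos h.1
    exact isPos_of_rootCoeff_pos (hl.trans_le (hj2 l))
  have hle : cor b j ≤ c := by
    intro l
    zify
    rw [cast_cor hB hjpos, hj1, Pi.add_apply, corootCoeff_simple, ← cast_cor hB h.1]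
    have : cor b i l ≤ c l := h.2.1 l
    rcases eq_or_ne l k with rfl | hlk
    · simp; omega
    · simp [hlk]; omega
  have := congrFun hj1 k
  rw [h.2.2 j hjpos hle hj2, corootCoeff_simple] at this
  simp at this

include hB in
/-- Distinct maximal roots of a degree have disjoint supports. -/
lemma IsMaxRoot.disjoint {c : b.support → ℕ} {i j : ι} (hi : IsMaxRoot b c i)
    (hj : IsMaxRoot b c j) (hij : i ≠ j) (k : b.support) : cor b i k = 0 ∨ cor b j k = 0 := by
  -- the two roots are incomparable, so that their difference is not a root
  have hpair : P.pairingIn ℤ i j ≤ 0 := by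
    by_contra! hpos
    obtain ⟨k, hk⟩ := P.root_sub_root_mem_of_pairingIn_pos hpos hij
    have hk' : P.root k = (1 : ℤ) • P.root i + (-1 : ℤ) • P.root j := by
      rw [hk]; simp [sub_eq_add_neg]
    have hk := rootCoeff_eq_of_root_eq (b := b) hk'
    rcases rootCoeff_nonneg_or_nonpos (b := b) k with h | h
    · exact hij (hj.2.2 i hi.1 hi.2.1 fun l => by
        have := h l
        rw [hk] at this
        simp at this ⊢; omega)
    · exact hij.symm (hi.2.2 j hj.1 hj.2.1 fun l => by
        have := h l
        rw [hk] at this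
        simp at this ⊢; omega)
  have hform : ∀ (i l : ι), 0 ≤ P.pairingIn ℤ i l → 0 ≤ B.form (P.root i) (P.root l) := by
    intro i l h
    have e := B.two_mul_apply_root_root i l
    have e1 := form_root_pos hB l
    rw [← cast_pairingIn] at e
    have : (0 : ℝ) ≤ P.pairingIn ℤ i l := by exact_mod_cast h
    nlinarith [mul_nonneg this e1.le]
  set p : b.support → ℤ := fun k => min (cor b i k) (cor b j k) with hp
  set x : b.support → ℤ := fun k => cor b i k - p k with hx
  set y : b.support → ℤ := fun k => cor b j k - p k with hy
  have ei : p + x = corootCoeff b i := by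
    funext k; rw [← cast_cor hB hi.1]; simp [hx]
  have ej : p + y = corootCoeff b j := by
    funext k; rw [← cast_cor hB hj.1]; simp [hy]
  have hx0 : 0 ≤ x := fun k => by simp [hx, hp]
  have hy0 : 0 ≤ y := fun k => by simp [hy, hp]
  have h1 : 0 ≤ B.form (corootVec B (p + x)) (corootVec B y) := by
    rw [ei, corootVec_corootCoeff hB]
    rw [← corootVec_corootCoeff (b := b) hB]
    refine form_corootVec_nonneg hB hy0 fun l hl => ?_
    have := form_root_pos hB i
    rw [corootVec_corootCoeff hB, map_smul, LinearMap.smul_apply, smul_eq_mul]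
    refine mul_nonneg (by positivity) (hform _ _ (hi.pairing_nonneg hB ?_))
    have : cor b j l ≤ c l := hj.2.1 l
    simp only [hy, hp] at hl
    omega
  have h2 : 0 ≤ B.form (corootVec B (p + y)) (corootVec B x) := by
    rw [ej]
    refine form_corootVec_nonneg hB hx0 fun l hl => ?_
    have := form_root_pos hB j
    rw [corootVec_corootCoeff hB, map_smul, LinearMap.smul_apply, smul_eq_mul]
    refine mul_nonneg (by positivity) (hform _ _ (hj.pairing_nonneg hB ?_))
    have : cor b i l ≤ c l := hi.2.1 l
    simp only [hx, hp] at hl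
    omega
  have h3 : B.form (corootVec B x) (corootVec B y) ≤ 0 := by
    refine form_corootVec_nonpos hB hy0 fun l hl => ?_
    rw [form_corootVec hB]
    refine Finset.sum_nonpos fun k _ => ?_
    rw [root_coroot_eq_pairing, ← cast_pairingIn]
    rcases eq_or_ne l k with rfl | hlk
    · have : x l = 0 := by simp only [hx, hy, hp] at hl ⊢; omega
      simp [this]
    · refine mul_nonpos_of_nonneg_of_nonpos (by exact_mod_cast hx0 k) ?_
      exact_mod_cast b.pairingIn_le_zero_of_ne (fun h => hlk (Subtype.ext h)) l.2 k.2
  have h4 : B.form (corootVec B (p + x)) (corootVec B (p + y)) ≤ 0 := by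
    rw [ei, ej, corootVec_corootCoeff hB, corootVec_corootCoeff hB]
    have e1 := form_root_pos hB i
    have e2 := form_root_pos hB j
    have e3 := B.two_mul_apply_root_root i j
    rw [← cast_pairingIn] at e3
    have e4 : (P.pairingIn ℤ i j : ℝ) ≤ 0 := by exact_mod_cast hpair
    have e5 : B.form (P.root i) (P.root j) ≤ 0 := by nlinarith [mul_nonneg (neg_nonneg.2 e4) e2.le]
    simp only [map_smul, LinearMap.smul_apply, smul_eq_mul]
    exact mul_nonpos_of_nonneg_of_nonpos (by positivity)
      (mul_nonpos_of_nonneg_of_nonpos (by positivity) e5)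
  simp only [corootVec_add, map_add, LinearMap.add_apply] at h1 h2 h4
  rw [form_comm B (corootVec B y) (corootVec B x)] at h2
  rw [form_comm B (corootVec B x) (corootVec B p)] at h4
  have hp0 : p = 0 := by
    by_contra hne
    have := hB _ fun h => hne (eq_zero_of_corootVec_eq_zero hB h)
    linarith
  have := congrFun hp0 k
  simp only [hp, Pi.zero_apply] at this
  omega

end Pairing

end MaximalRoots

section GreedyDecompositions

variable {b : P.Base}

/-! ### Reflections in the Hecke monoid -/

lemma isPos_of_rootCoeff_nonneg {i : ι} (h : 0 ≤ rootCoeff b i) : b.IsPos i := by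
  rw [Base.isPos_iff', height_eq]
  exact Finset.sum_nonneg fun k _ => h k

section HeckeReflections

variable [Finite ι] [P.IsCrystallographic] [P.IsReduced]

omit [P.IsReduced] in
lemma not_isPos_reflectionPerm_of_pairing_pos {a : ι} (ha : b.IsPos a) (i : b.support)
    (h : 0 < P.pairingIn ℤ a i) : ¬ b.IsPos (P.reflectionPerm a i) := by
  classical
  have h' : 0 < P.pairingIn ℤ i a := (P.zero_lt_pairingIn_iff' ℤ).1 h
  intro hp
  have e : ∀ l, rootCoeff b (P.reflectionPerm a i) l =
      (Pi.single i 1 : b.support → ℤ) l - P.pairingIn ℤ i a * rootCoeff b a l := by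
    intro l
    rw [rootCoeff_reflectionPerm, rootCoeff_simple]
    simp
  obtain ⟨l, hl⟩ := exists_rootCoeff_pos hp
  obtain ⟨m, hm⟩ := exists_rootCoeff_pos ha
  have hm' : 0 ≤ rootCoeff b (P.reflectionPerm a i) m := rootCoeff_nonneg hp m
  have hl' : 0 ≤ rootCoeff b a l := rootCoeff_nonneg ha l
  rw [e] at hl hm'
  have hmul := mul_pos h' hm
  have hmi : m = i := by
    by_contra hne
    rw [Pi.single_eq_of_ne hne] at hm'
    omega
  have hli : l = i := by
    by_contra hne
    rw [Pi.single_eq_of_ne hne] at hl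
    nlinarith
  subst hmi hli
  rw [Pi.single_eq_same] at hl
  omega

lemma heckeRefl_mul_of_pairing_pos {a : ι} (ha : b.IsPos a) (i : b.support)
    (h : 0 < P.pairingIn ℤ a i) : heckeRefl b a * heckeRefl b i = heckeRefl b a :=
  heckeRefl_mul_of_not_isPos b i.2 (not_isPos_reflectionPerm_of_pairing_pos ha i h)

lemma mul_heckeRefl_of_pairing_pos {a : ι} (ha : b.IsPos a) (i : b.support)
    (h : 0 < P.pairingIn ℤ a i) : heckeRefl b i * heckeRefl b a = heckeRefl b a :=
  mul_heckeRefl_of_not_isPos b i.2 (not_isPos_reflectionPerm_of_pairing_pos ha i h)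

lemma commute_heckeRefl {a : ι} (ha : b.IsPos a) (i : b.support)
    (h : 0 ≤ P.pairingIn ℤ a i) : Commute (heckeRefl b a) (heckeRefl b i) := by
  rcases h.eq_or_lt with h | h
  · refine commute_heckeRefl_of_pairing_eq_zero b i.2 ?_
    rw [← cast_pairingIn, (P.pairingIn_eq_zero_iff (S := ℤ)).1 h.symm, Int.cast_zero]
  · rw [Commute, SemiconjBy, heckeRefl_mul_of_pairing_pos ha i h,
      mul_heckeRefl_of_pairing_pos ha i h]

lemma heckeRefl_conj_of_pairing_neg {a : ι} (ha : b.IsPos a) (i : b.support)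
    (h : P.pairingIn ℤ a i < 0) :
    heckeRefl b i * heckeRefl b a * heckeRefl b i = heckeRefl b (P.reflectionPerm i a) := by
  have h' : P.pairingIn ℤ i a < 0 := (P.pairingIn_lt_zero_iff ℤ).1 h
  have hi := RootPairing.Base.isPos_of_mem_support i.2
  have hai : a ≠ i := by
    rintro rfl
    rw [P.pairingIn_same] at h
    omega
  refine heckeRefl_conj b i.2 (isPos_of_rootCoeff_nonneg fun l => ?_) ?_
  · have e1 := rootCoeff_nonneg hi l
    have e2 := rootCoeff_nonneg ha l
    rw [rootCoeff_reflectionPerm]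
    simp only [Pi.zero_apply, Pi.sub_apply, Pi.smul_apply, smul_eq_mul] at e1 e2 ⊢
    nlinarith
  · have e : rootCoeff b (P.reflectionPerm i (P.reflectionPerm a i)) =
        (-P.pairingIn ℤ i a) • rootCoeff b (P.reflectionPerm i a) - rootCoeff b i := by
      have : P.root (P.reflectionPerm i (P.reflectionPerm a i)) =
          (-P.pairingIn ℤ i a) • P.root (P.reflectionPerm i a) + (-1 : ℤ) • P.root i := by
        rw [P.root_reflectionPerm, P.root_reflectionPerm, P.reflection_apply_root, map_sub,
          P.reflection_apply_self, map_smul, ← cast_pairingIn, Int.cast_smul_eq_zsmul,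
          ← P.root_reflectionPerm]
        simp only [neg_smul, one_smul]
        abel
      rw [rootCoeff_eq_of_root_eq this]
      simp [sub_eq_add_neg]
    refine isPos_of_rootCoeff_nonneg fun l => ?_
    have e1 := rootCoeff_nonneg hi l
    have e2 := rootCoeff_nonneg ha l
    rw [e]
    simp only [rootCoeff_reflectionPerm, Pi.zero_apply, Pi.sub_apply, Pi.smul_apply,
      smul_eq_mul] at e1 e2 ⊢
    nlinarith [mul_nonneg (show (0 : ℤ) ≤ -P.pairingIn ℤ i a by omega) e2,
      mul_nonneg (show 0 ≤ P.pairingIn ℤ i a * P.pairingIn ℤ a i - 1 by nlinarith) e1]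

/-- A reflection is a Hecke product of simple reflections in the support of its root. -/
lemma heckeRefl_mem_closure {a : ι} (ha : b.IsPos a) :
    heckeRefl b a ∈ Submonoid.closure
      ((fun k : b.support => heckeRefl b k) '' {k | 0 < rootCoeff b a k}) := by
  classical
  generalize hn : (b.height a).toNat = n
  induction n using Nat.strongRecOn generalizing a with
  | ind n ih =>
    obtain ⟨j, hj, hj'⟩ := ha.exists_mem_support_pos_pairingIn
    rw [P.zero_lt_pairingIn_iff'] at hj'
    rcases eq_or_ne a j with rfl | haj
    · exact Submonoid.subset_closure ⟨⟨a, hj⟩, by simp [rootCoeff_simple ⟨a, hj⟩], rfl⟩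
    · have ha' := ha.reflectionPerm hj haj
      have e := rootCoeff_reflectionPerm (b := b) a j
      have hs := rootCoeff_simple (b := b) ⟨j, hj⟩
      have hjpos : 0 < rootCoeff b a ⟨j, hj⟩ := by
        have := rootCoeff_nonneg ha' ⟨j, hj⟩
        rw [e, Pi.zero_apply, Pi.sub_apply, Pi.smul_apply, hs] at this
        simp at this
        omega
      have hlt : b.height (P.reflectionPerm j a) < b.height a := by
        rw [height_eq, height_eq, e, hs]
        refine Finset.sum_lt_sum (fun k _ => ?_) ⟨⟨j, hj⟩, Finset.mem_univ _, by simpa⟩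
        have : (0 : ℤ) ≤ (Pi.single ⟨j, hj⟩ 1 : b.support → ℤ) k :=
          (Pi.single_nonneg.2 zero_le_one : (0 : b.support → ℤ) ≤ _) k
        simp only [Pi.sub_apply, Pi.smul_apply, smul_eq_mul]
        nlinarith
      have hmem : heckeRefl b j ∈ Submonoid.closure
          ((fun k : b.support => heckeRefl b k) '' {k | 0 < rootCoeff b a k}) :=
        Submonoid.subset_closure ⟨⟨j, hj⟩, hjpos, rfl⟩
      have hneg : P.pairingIn ℤ (P.reflectionPerm j a) j < 0 := by
        rw [← P.pairingIn_reflectionPerm, P.pairingIn_reflectionPerm_self_right]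
        omega
      have hconj := heckeRefl_conj_of_pairing_neg ha' ⟨j, hj⟩ hneg
      simp only [P.reflectionPerm_self] at hconj
      rw [← hconj]
      have h0 := (Base.isPos_iff _).1 ha'
      refine mul_mem (mul_mem hmem ?_) hmem
      refine Submonoid.closure_mono (Set.image_mono fun k hk => ?_)
        (ih (b.height (P.reflectionPerm j a)).toNat (by omega) ha' rfl)
      simp only [Set.mem_ofPred_eq] at hk ⊢
      rw [e, hs] at hk
      refine lt_of_lt_of_le hk ?_
      simp only [Pi.sub_apply, Pi.smul_apply, smul_eq_mul]
      have : (0 : ℤ) ≤ (Pi.single ⟨j, hj⟩ 1 : b.support → ℤ) k :=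
        (Pi.single_nonneg.2 zero_le_one : (0 : b.support → ℤ) ≤ _) k
      nlinarith

lemma commute_of_mem_closure {a : ι} (ha : b.IsPos a) {S : Set b.support}
    (hS : ∀ k ∈ S, 0 ≤ P.pairingIn ℤ a k) {x : HeckeMonoid b}
    (hx : x ∈ Submonoid.closure ((fun k : b.support => heckeRefl b k) '' S)) :
    Commute (heckeRefl b a) x := by
  induction hx using Submonoid.closure_induction with
  | mem x hx =>
    obtain ⟨k, hk, rfl⟩ := hx
    exact commute_heckeRefl ha k (hS k hk)
  | one => exact Commute.one_right _
  | mul x y _ _ hx hy => exact hx.mul_right hy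

end HeckeReflections

/-! ### Greedy decompositions -/

variable (b) in
/-- Greedy decompositions of the degree with coefficients `c`. -/
inductive GreedyList : (b.support → ℕ) → List ι → Prop
  | nil : GreedyList 0 []
  | cons {i : ι} {l : List ι} {c : b.support → ℕ} :
      IsMaxRoot b c i → GreedyList (c - cor b i) l → GreedyList c (i :: l)

lemma IsMaxRoot.mono {c c' : b.support → ℕ} {i : ι} (h : IsMaxRoot b c i) (hc : c' ≤ c)
    (hi : cor b i ≤ c') : IsMaxRoot b c' i :=
  ⟨h.1, hi, fun j hj hj' => h.2.2 j hj (hj'.trans hc)⟩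

variable {B : P.InvariantForm} (hB : ∀ x : M, x ≠ 0 → 0 < B.form x x)

include hB in
lemma exists_cor_pos {i : ι} (hi : b.IsPos i) : ∃ k, 0 < cor b i k := by
  obtain ⟨k, hk⟩ := exists_rootCoeff_pos hi
  exact ⟨k, (cor_pos_iff hB).2 hk⟩

include hB in
lemma sum_sub_cor_lt {c : b.support → ℕ} {i : ι} (hi : b.IsPos i) (h : cor b i ≤ c) :
    ∑ k, (c - cor b i) k < ∑ k, c k := by
  obtain ⟨k, hk⟩ := exists_cor_pos hB hi
  refine Finset.sum_lt_sum (fun k _ => Nat.sub_le _ _) ⟨k, Finset.mem_univ k, ?_⟩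
  have : cor b i k ≤ c k := h k
  simp only [Pi.sub_apply]
  omega

lemma cor_simple [DecidableEq b.support] (k : b.support) : cor b k = Pi.single k 1 := by
  funext l
  rw [cor, corootCoeff_simple]
  rcases eq_or_ne l k with rfl | h
  · simp
  · simp [h]

lemma cor_simple_le {c : b.support → ℕ} {k : b.support} (h : 0 < c k) : cor b k ≤ c := by
  classical
  rw [cor_simple]
  intro l
  rcases eq_or_ne l k with rfl | hl
  · simpa [Nat.one_le_iff_ne_zero] using h.ne'
  · simp [hl]

include hB in
lemma exists_greedyList [Finite ι] (c : b.support → ℕ) : ∃ l, GreedyList b c l := by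
  classical
  generalize hn : ∑ k, c k = n
  induction n using Nat.strongRecOn generalizing c with
  | ind n ih =>
    by_cases hc : c = 0
    · exact ⟨[], hc ▸ GreedyList.nil⟩
    · obtain ⟨k, hk⟩ := Function.ne_iff.1 hc
      have hkc : cor b k ≤ c := cor_simple_le (Nat.pos_of_ne_zero hk)
      obtain ⟨i, hi, -⟩ := exists_isMaxRoot_ge (Base.isPos_of_mem_support k.2) hkc
      obtain ⟨l, hl⟩ := ih _ (hn ▸ sum_sub_cor_lt hB hi.1 hi.2.1) (c - cor b i) rfl
      exact ⟨i :: l, .cons hi hl⟩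

variable [Finite ι] [P.IsCrystallographic] [P.IsReduced]

variable (b) in
/-- The Hecke product of the reflections in a list of roots. -/
noncomputable def heckeProd (l : List ι) : HeckeMonoid b := (l.map (heckeRefl b)).prod

lemma heckeProd_cons (i : ι) (l : List ι) :
    heckeProd b (i :: l) = heckeRefl b i * heckeProd b l := by
  simp [heckeProd]

include hB in
lemma IsMaxRoot.commute {c : b.support → ℕ} {i j : ι} (hi : IsMaxRoot b c i)
    (hj : b.IsPos j) (h : ∀ k, 0 < cor b j k → cor b i k < c k) :
    Commute (heckeRefl b i) (heckeRefl b j) :=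
  commute_of_mem_closure hi.1 (fun k hk => hi.pairing_nonneg hB (h k ((cor_pos_iff hB).2 hk)))
    (heckeRefl_mem_closure hj)

include hB in
lemma IsMaxRoot.le_sub {c : b.support → ℕ} {i j : ι} (hi : IsMaxRoot b c i)
    (hj : IsMaxRoot b c j) (hij : i ≠ j) : cor b j ≤ c - cor b i := by
  intro k
  have h1 : cor b i k ≤ c k := hi.2.1 k
  have h2 : cor b j k ≤ c k := hj.2.1 k
  have := hi.disjoint hB hj hij k
  simp only [Pi.sub_apply]
  omega

include hB in
/-- Greedy decompositions of a degree are unique up to reordering, and their Hecke products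
agree. -/
lemma GreedyList.unique {c : b.support → ℕ} {l l' : List ι} (h : GreedyList b c l)
    (h' : GreedyList b c l') : l.Perm l' ∧ heckeProd b l = heckeProd b l' := by
  generalize hn : ∑ k, c k = n
  induction n using Nat.strongRecOn generalizing c l l' with
  | ind n ih =>
    have hne : ∀ i, ¬ IsMaxRoot b 0 i := fun i hi => by
      obtain ⟨k, hk⟩ := exists_cor_pos hB hi.1
      have : cor b i k ≤ 0 := hi.2.1 k
      omega
    cases h with
    | nil =>
      cases h' with
      | nil => exact ⟨.refl _, rfl⟩
      | cons hi _ => exact absurd hi (hne _)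
    | cons hi hl =>
      rename_i i l
      cases h' with
      | nil => exact absurd hi (hne _)
      | cons hj hl' =>
        rename_i j l'
        have lti := hn ▸ sum_sub_cor_lt hB hi.1 hi.2.1
        have ltj := hn ▸ sum_sub_cor_lt hB hj.1 hj.2.1
        rcases eq_or_ne i j with rfl | hij
        · obtain ⟨h1, h2⟩ := ih _ lti hl hl' rfl
          exact ⟨h1.cons _, by rw [heckeProd_cons, heckeProd_cons, h2]⟩
        · have hji := hi.le_sub hB hj hij
          have hij' := hj.le_sub hB hi hij.symm
          obtain ⟨m, hm⟩ := exists_greedyList hB (c - cor b i - cor b j)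
          have g1 : GreedyList b (c - cor b i) (j :: m) := .cons (hj.mono tsub_le_self hji) hm
          have g2 : GreedyList b (c - cor b j) (i :: m) :=
            .cons (hi.mono tsub_le_self hij') (by rwa [tsub_right_comm])
          obtain ⟨p1, e1⟩ := ih _ lti hl g1 rfl
          obtain ⟨p2, e2⟩ := ih _ ltj hl' g2 rfl
          refine ⟨(p1.cons i).trans ((List.Perm.swap j i m).trans (p2.cons j).symm), ?_⟩
          have hcomm : Commute (heckeRefl b i) (heckeRefl b j) :=
            hi.commute hB hj.1 fun k hk => by
              have : cor b j k ≤ c k - cor b i k := hji k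
              omega
          rw [heckeProd_cons, heckeProd_cons, e1, e2, heckeProd_cons, heckeProd_cons, ← mul_assoc,
            ← mul_assoc, hcomm.eq]

end GreedyDecompositions

section Recursion

variable {b : P.Base}

/-! ### A recursion for the Hecke product of a greedy decomposition -/

variable {B : P.InvariantForm} (hB : ∀ x : M, x ≠ 0 → 0 < B.form x x)
  [Finite ι] [P.IsCrystallographic] [P.IsReduced]

variable (b) in
/-- The Hecke product of the reflections in a greedy decomposition of the degree with
coefficients `c`. -/
noncomputable def heckeDeg (c : b.support → ℕ) : HeckeMonoid b :=
  heckeProd b (Classical.epsilon fun l => GreedyList b c l)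

variable (b) in
open Classical in
/-- The part of a degree which is supported on the simple roots orthogonal to the root `a`. -/
noncomputable def orthPart (a : ι) (c : b.support → ℕ) : b.support → ℕ :=
  fun k => if P.pairingIn ℤ a k = 0 then c k else 0

omit [Finite ι] [P.IsReduced] in
lemma orthPart_le (a : ι) (c : b.support → ℕ) : orthPart b a c ≤ c := by
  intro k
  unfold orthPart
  split_ifs
  · exact le_rfl
  · exact Nat.zero_le _

omit [P.IsReduced] in
lemma pairing_simple_nonpos {i k : b.support} (h : i ≠ k) : P.pairingIn ℤ i k ≤ 0 :=
  b.pairingIn_le_zero_of_ne (fun h' => h (Subtype.ext h')) i.2 k.2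

include hB

lemma GreedyList.heckeDeg_eq {c : b.support → ℕ} {l : List ι} (h : GreedyList b c l) :
    heckeDeg b c = heckeProd b l :=
  ((Classical.epsilon_spec (p := fun l => GreedyList b c l) ⟨l, h⟩).unique hB h).2

lemma IsMaxRoot.heckeDeg_eq {c : b.support → ℕ} {i : ι} (h : IsMaxRoot b c i) :
    heckeDeg b c = heckeRefl b i * heckeDeg b (c - cor b i) := by
  obtain ⟨l, hl⟩ := exists_greedyList hB (c - cor b i)
  rw [hl.heckeDeg_eq hB, (GreedyList.cons h hl).heckeDeg_eq hB, heckeProd_cons]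

lemma GreedyList.heckeProd_mem {c : b.support → ℕ} {l : List ι} (h : GreedyList b c l) :
    heckeProd b l ∈ Submonoid.closure ((fun k : b.support => heckeRefl b k) '' {k | 0 < c k}) := by
  induction h with
  | nil => exact one_mem _
  | @cons i l c hi hl ih =>
    rw [heckeProd_cons]
    refine mul_mem ?_ ?_
    · refine Submonoid.closure_mono (Set.image_mono fun k hk => ?_) (heckeRefl_mem_closure hi.1)
      exact lt_of_lt_of_le ((cor_pos_iff hB).2 hk) (hi.2.1 k)
    · refine Submonoid.closure_mono (Set.image_mono fun k hk => ?_) ih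
      exact lt_of_lt_of_le hk (Nat.sub_le _ _)

lemma commute_heckeDeg {a : ι} (ha : b.IsPos a) {c : b.support → ℕ}
    (h : ∀ k : b.support, 0 < c k → 0 ≤ P.pairingIn ℤ a k) :
    Commute (heckeRefl b a) (heckeDeg b c) := by
  obtain ⟨l, hl⟩ := exists_greedyList hB c
  rw [hl.heckeDeg_eq hB]
  exact commute_of_mem_closure ha h (hl.heckeProd_mem hB)

omit hB [P.IsReduced] in
lemma degPairing_le_orthPart (a : ι) {c : b.support → ℕ} {i : b.support}
    (h : P.pairingIn ℤ a i = 0) : degPairing b c i ≤ degPairing b (orthPart b a c) i := by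
  refine Finset.sum_le_sum fun k _ => ?_
  unfold orthPart
  split_ifs with hk
  · exact le_rfl
  · have hik : i ≠ k := by rintro rfl; exact hk h
    rw [Nat.cast_zero, zero_mul]
    exact mul_nonpos_of_nonneg_of_nonpos (Nat.cast_nonneg _) (pairing_simple_nonpos hik)

omit hB [P.IsCrystallographic] [P.IsReduced] [Finite ι] in
lemma sum_sub_single_lt [DecidableEq b.support] {c : b.support → ℕ} {i : b.support}
    (h : 0 < c i) : ∑ k, (c - Pi.single i 1 : b.support → ℕ) k < ∑ k, c k := by
  refine Finset.sum_lt_sum (fun k _ => Nat.sub_le _ _) ⟨i, Finset.mem_univ i, ?_⟩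
  simp only [Pi.sub_apply, Pi.single_eq_same]
  omega

/-- After Hecke multiplication by the reflection in `a`, only the part of the degree orthogonal
to `a` matters, because `s_a` commutes with, and absorbs, the remaining simple reflections. -/
lemma heckeRefl_mul_heckeDeg [DecidableEq b.support] {a : ι} (ha : b.IsPos a)
    {g : b.support → ℕ} (hg : ∀ k : b.support, 0 < g k → 0 ≤ P.pairingIn ℤ a k)
    (hrec : ∀ c ≤ g, ∀ i : b.support, 0 < degPairing b c i →
      heckeDeg b c = heckeRefl b i * heckeDeg b (c - Pi.single i 1) * heckeRefl b i) :
    heckeRefl b a * heckeDeg b g = heckeRefl b a * heckeDeg b (orthPart b a g) := by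
  generalize hn : ∑ k, g k = n
  induction n using Nat.strongRecOn generalizing g with
  | ind n ih =>
    by_cases h0 : g = 0
    · have : orthPart b a g = g := by
        funext k; simp [orthPart, h0]
      rw [this]
    · obtain ⟨i, hi⟩ := exists_degPairing_pos hB h0
      have hgi := pos_of_degPairing_pos hi
      have hle : g - Pi.single i 1 ≤ g := tsub_le_self
      have hg' : ∀ k : b.support, 0 < (g - Pi.single i 1 : b.support → ℕ) k →
          0 ≤ P.pairingIn ℤ a k := fun k hk => hg k (hk.trans_le (hle k))
      have hih := ih _ (hn ▸ sum_sub_single_lt hgi) hg' (fun c hc => hrec c (hc.trans hle)) rfl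
      have hcomm := commute_heckeDeg hB ha hg'
      have hcommi := commute_heckeRefl ha i (hg i hgi)
      rw [hrec g le_rfl i hi]
      rcases (hg i hgi).eq_or_lt with hz | hpos
      · have e : orthPart b a (g - Pi.single i 1) = orthPart b a g - Pi.single i 1 := by
          funext k
          rcases eq_or_ne k i with rfl | hk
          · simp [orthPart, ← hz]
          · simp [orthPart, hk]
        rw [hrec _ (orthPart_le a g) i (hi.trans_le (degPairing_le_orthPart a hz.symm)), ← e]
        simp only [← mul_assoc]
        rw [hcommi.eq, mul_assoc (heckeRefl b i), hih]
        simp only [← mul_assoc]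
      · have e : orthPart b a (g - Pi.single i 1) = orthPart b a g := by
          funext k
          rcases eq_or_ne k i with rfl | hk
          · simp [orthPart, hpos.ne']
          · simp [orthPart, hk]
        rw [← e, ← hih]
        simp only [← mul_assoc]
        rw [heckeRefl_mul_of_pairing_pos ha i hpos, hcomm.eq, mul_assoc,
          heckeRefl_mul_of_pairing_pos ha i hpos]

/-- A maximal root `a` of a degree pairs with a simple root `i ≠ a` to at most `⟨i, a^∨⟩ = 1`:
otherwise `-s_a i` would be a larger root with a smaller coroot. -/
lemma IsMaxRoot.pairing_eq_one {c : b.support → ℕ} {a : ι} (h : IsMaxRoot b c a) {i : b.support}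
    (hai : a ≠ i) (hpos : 0 < P.pairingIn ℤ i a) : P.pairingIn ℤ i a = 1 := by
  classical
  have hi := RootPairing.Base.isPos_of_mem_support i.2
  refine (pairing_eq_one_or hai.symm hi h.1 hpos).elim id fun h1 => ?_
  by_contra hne
  have hr : rootCoeff b i ≤ rootCoeff b a := by
    have h2 := rootCoeff_nonneg (h.1.reflectionPerm i.2 hai)
    rw [rootCoeff_reflectionPerm, h1, one_smul] at h2
    exact sub_nonneg.1 h2
  set η := P.reflectionPerm (P.reflectionPerm a i) (P.reflectionPerm a i) with hη
  have e1 : rootCoeff b η = P.pairingIn ℤ i a • rootCoeff b a - rootCoeff b i := by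
    rw [hη, rootCoeff_reflectionPerm_self, rootCoeff_reflectionPerm, neg_sub]
  have e2 : corootCoeff b η = corootCoeff b a - corootCoeff b i := by
    rw [hη, corootCoeff_reflectionPerm_self, corootCoeff_reflectionPerm, h1, one_smul, neg_sub]
  have hle : rootCoeff b a ≤ rootCoeff b η := by
    intro k
    have f1 : rootCoeff b i k ≤ rootCoeff b a k := hr k
    have f2 : 0 ≤ rootCoeff b a k := rootCoeff_nonneg h.1 k
    rw [e1]
    simp only [Pi.sub_apply, Pi.smul_apply, smul_eq_mul]
    nlinarith [mul_nonneg (show 0 ≤ P.pairingIn ℤ i a - 2 by omega) f2]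
  have hηpos : b.IsPos η := isPos_of_rootCoeff_nonneg ((rootCoeff_nonneg h.1).trans hle)
  have hc : cor b η ≤ c := by
    intro k
    have f1 : cor b a k ≤ c k := h.2.1 k
    have f2 : 0 ≤ corootCoeff b i k := corootCoeff_nonneg hB hi k
    have f3 := cast_cor hB hηpos k
    have f4 := cast_cor hB h.1 k
    rw [e2, Pi.sub_apply] at f3
    change cor b η k ≤ c k
    omega
  have := congrFun e2 i
  rw [h.2.2 η hηpos hc hle, corootCoeff_simple] at this
  simp only [Pi.sub_apply, Pi.single_eq_same] at this
  omega

omit [Finite ι] [P.IsReduced] in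
/-- If a root `j` lies between `s_i a` and `a`, and `s_i a = a - K i` with `0 < K`, then either
`j = s_i a` or the coefficient of `j^∨` at `i` exceeds that of `(s_i a)^∨`, since `j` is not
longer than `a`. -/
lemma eq_of_between {a a' j : ι} {i : b.support} {K : ℤ}
    (ha : rootCoeff b a = rootCoeff b a' + K • rootCoeff b i) (hK : P.pairingIn ℤ a' i = -K)
    (hj : b.IsPos j) (h1 : rootCoeff b a' ≤ rootCoeff b j) (h2 : rootCoeff b j ≤ rootCoeff b a)
    (h3 : corootCoeff b j i ≤ corootCoeff b a' i) : j = a' := by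
  classical
  set x := rootCoeff b j i - rootCoeff b a' i with hx
  have hjx : rootCoeff b j = rootCoeff b a' + x • rootCoeff b i := by
    funext k
    have f1 : rootCoeff b a' k ≤ rootCoeff b j k := h1 k
    have f2 : rootCoeff b j k ≤ rootCoeff b a k := h2 k
    rw [ha, rootCoeff_simple] at f2
    rw [rootCoeff_simple]
    rcases eq_or_ne k i with rfl | hk
    · simp [hx]
    · simp [hk] at f2 ⊢
      omega
  have hxK : x ≤ K := by
    have f2 : rootCoeff b j i ≤ rootCoeff b a i := h2 i
    rw [ha, rootCoeff_simple] at f2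
    simp at f2
    omega
  have hx0 : 0 ≤ x := sub_nonneg.2 (h1 i)
  rcases hx0.eq_or_lt with h0 | h0
  · exact rootCoeff_injective (b := b) (by rw [hjx, ← h0]; simp)
  · exfalso
    have hroot : P.root j = P.root a' + (x : ℝ) • P.root i := by
      rw [root_eq_sum b j, hjx, Int.cast_smul_eq_zsmul]
      conv_rhs => rw [root_eq_sum b a', root_eq_sum b i]
      simp [add_smul, mul_smul, Finset.sum_add_distrib, Finset.smul_sum]
    have n1 := B.two_mul_apply_root_root a' i
    rw [← cast_pairingIn, hK] at n1
    have n2 : B.form (P.root j) (P.root j) = B.form (P.root a') (P.root a') +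
        x * (2 * B.form (P.root a') (P.root i)) + x * x * B.form (P.root i) (P.root i) := by
      rw [hroot]
      simp only [map_add, LinearMap.add_apply, map_smul, LinearMap.smul_apply, smul_eq_mul,
        form_comm B (P.root i) (P.root a')]
      ring
    have hii := form_root_pos hB (i : ι)
    have n3 : B.form (P.root j) (P.root j) ≤ B.form (P.root a') (P.root a') := by
      have q1 : (0 : ℝ) < x := by exact_mod_cast h0
      have q2 : (0 : ℝ) ≤ K - x := by rw [sub_nonneg]; exact_mod_cast hxK
      rw [n2, n1]
      push_cast
      nlinarith [mul_nonneg (mul_nonneg q1.le q2) hii.le]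
    have m1 := corootCoeff_mul_form (b := b) hB j i
    have m2 := corootCoeff_mul_form (b := b) hB a' i
    have m3 : (0 : ℝ) ≤ corootCoeff b j i := by exact_mod_cast corootCoeff_nonneg hB hj i
    have m4 : (corootCoeff b j i : ℝ) ≤ corootCoeff b a' i := by exact_mod_cast h3
    have m5 : (rootCoeff b a' i : ℝ) < rootCoeff b j i := by exact_mod_cast sub_pos.1 h0
    have m6 := form_root_pos hB a'
    nlinarith [mul_le_mul_of_nonneg_left n3 m3, mul_le_mul_of_nonneg_right m4 m6.le,
      mul_lt_mul_of_pos_right m5 hii]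

omit hB [P.IsReduced] in
/-- A simple root which is not in the support of a degree, and pairs to zero with it, is
orthogonal to its support. -/
lemma pairing_eq_zero_of_degPairing_eq_zero {c : b.support → ℕ} {i : b.support} (hi : c i = 0)
    (h : degPairing b c i = 0) {k : b.support} (hk : 0 < c k) : P.pairingIn ℤ i k = 0 := by
  have hle : ∀ l ∈ Finset.univ, (c l * P.pairingIn ℤ i l : ℤ) ≤ 0 := by
    intro l _
    rcases eq_or_ne i l with rfl | hl
    · simp [hi]
    · exact mul_nonpos_of_nonneg_of_nonpos (Nat.cast_nonneg _)
        (b.pairingIn_le_zero_of_ne (fun h' => hl (Subtype.ext h')) i.2 l.2)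
  have := (Finset.sum_eq_zero_iff_of_nonpos hle).1 h k (Finset.mem_univ k)
  rcases mul_eq_zero.1 this with h' | h'
  · omega
  · exact h'

/-- If the maximal root `a` of `c` exhausts the coefficient of `c` at the simple root `i`, and
pairs positively with it, then `s_i a` is a maximal root of `c - i^∨`. -/
lemma IsMaxRoot.reflectionPerm [DecidableEq b.support] {c : b.support → ℕ} {a : ι}
    (h : IsMaxRoot b c a) {i : b.support} (hai : a ≠ i) (hci : cor b a i = c i)
    (hpos : 0 < P.pairingIn ℤ i a) :
    IsMaxRoot b (c - Pi.single i 1) (P.reflectionPerm i a) ∧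
      cor b (P.reflectionPerm i a) = cor b a - Pi.single i 1 ∧ 0 < cor b a i := by
  have hi := RootPairing.Base.isPos_of_mem_support i.2
  have h1 := h.pairing_eq_one hB hai hpos
  have hpos' : 0 < P.pairingIn ℤ a i := (P.zero_lt_pairingIn_iff' ℤ).1 hpos
  set a' := P.reflectionPerm i a with ha'
  have ha'pos : b.IsPos a' := h.1.reflectionPerm i.2 hai
  have er : rootCoeff b a = rootCoeff b a' + P.pairingIn ℤ a i • rootCoeff b i := by
    rw [ha', rootCoeff_reflectionPerm]; abel
  have ec : ∀ k, (cor b a' k : ℤ) = cor b a k - (Pi.single i 1 : b.support → ℕ) k := by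
    intro k
    rw [cast_cor hB ha'pos, cast_cor hB h.1, ha', corootCoeff_reflectionPerm, h1,
      corootCoeff_simple]
    rcases eq_or_ne k i with rfl | hk
    · simp
    · simp [hk]
  have ec' : cor b a' = cor b a - Pi.single i 1 := by
    funext k
    have := ec k
    simp only [Pi.sub_apply]
    omega
  have hai0 : 0 < cor b a i := by
    have := ec i
    rw [Pi.single_eq_same] at this
    omega
  refine ⟨⟨ha'pos, ?_, fun j hj hjc hja => ?_⟩, ec', hai0⟩
  · rw [ec']
    exact tsub_le_tsub_right h.2.1 _
  · obtain ⟨m, hm, hjm⟩ := exists_isMaxRoot_ge hj (hjc.trans tsub_le_self)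
    have hma : m = a := by
      by_contra hne
      obtain ⟨k, hk⟩ := exists_rootCoeff_pos ha'pos
      have k1 : rootCoeff b a' k ≤ rootCoeff b m k := (hja.trans hjm) k
      have k2 : rootCoeff b a' k ≤ rootCoeff b a k := by
        rw [er, Pi.add_apply, Pi.smul_apply, smul_eq_mul]
        have := rootCoeff_nonneg hi k
        rw [Pi.zero_apply] at this
        nlinarith
      have k3 := (cor_pos_iff hB (i := m) (k := k)).2 (by omega)
      have k4 := (cor_pos_iff hB (i := a) (k := k)).2 (by omega)
      rcases hm.disjoint hB h hne k with h' | h' <;> omega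
    rw [hma] at hjm
    refine eq_of_between hB er ?_ hj hja hjm ?_
    · rw [ha', ← P.pairingIn_reflectionPerm, P.pairingIn_reflectionPerm_self_right]
    · rw [← cast_cor hB hj, ← cast_cor hB ha'pos]
      have k1 : cor b j i ≤ c i - (Pi.single i 1 : b.support → ℕ) i := hjc i
      have := ec i
      rw [Pi.single_eq_same] at this k1
      omega

/-- The recursion: if the simple root `i` pairs positively with a degree, then the Hecke product
of the degree is obtained from that of the degree minus `i^∨` by Hecke conjugation by `s_i`. -/
lemma heckeDeg_eq_conj [DecidableEq b.support] (c : b.support → ℕ) (i : b.support)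
    (hi : 0 < degPairing b c i) :
    heckeDeg b c = heckeRefl b i * heckeDeg b (c - Pi.single i 1) * heckeRefl b i := by
  generalize hn : ∑ k, c k = n
  induction n using Nat.strongRecOn generalizing c i with
  | ind n ih =>
    have hci := pos_of_degPairing_pos hi
    have hipos := RootPairing.Base.isPos_of_mem_support i.2
    obtain ⟨a, ha, -⟩ : ∃ a, IsMaxRoot b c a ∧ rootCoeff b i ≤ rootCoeff b a :=
      exists_isMaxRoot_ge hipos (cor_simple_le hci)
    have hac : cor b a i ≤ c i := ha.2.1 i
    have hlt := hn ▸ sum_sub_cor_lt hB ha.1 ha.2.1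
    have hpair : degPairing b (c - cor b a) i = degPairing b c i - P.pairingIn ℤ i a := by
      rw [degPairing_sub ha.2.1, degPairing_cor hB ha.1]
    have hnonneg : ∀ k : b.support, 0 < (c - cor b a) k → 0 ≤ P.pairingIn ℤ a k := fun k hk =>
      ha.pairing_nonneg hB (by simp only [Pi.sub_apply] at hk; omega)
    have hcomm := commute_heckeDeg hB ha.1 hnonneg
    rw [ha.heckeDeg_eq hB]
    rcases hac.lt_or_eq with hlti | heq
    · -- the simple root `i` still occurs in the degree which remains after removing `a`
      have hai : 0 ≤ P.pairingIn ℤ a i := ha.pairing_nonneg hB hlti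
      have hle : cor b a ≤ c - Pi.single i 1 := by
        intro k
        have : cor b a k ≤ c k := ha.2.1 k
        rcases eq_or_ne k i with rfl | hk
        · simp; omega
        · simp [hk]; exact this
      have hcommi := commute_heckeRefl ha.1 i hai
      rw [(ha.mono tsub_le_self hle).heckeDeg_eq hB, tsub_right_comm]
      rcases hai.eq_or_lt with hz | hpos
      · have hz' : P.pairingIn ℤ i a = 0 := (P.pairingIn_eq_zero_iff (S := ℤ)).1 hz.symm
        rw [ih _ hlt (c - cor b a) i (by omega) rfl]
        simp only [← mul_assoc]
        rw [hcommi.eq]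
      · have e : orthPart b a (c - cor b a) = orthPart b a (c - cor b a - Pi.single i 1) := by
          funext k
          rcases eq_or_ne k i with rfl | hk
          · simp [orthPart, hpos.ne']
          · simp [orthPart, hk]
        have hnonneg' : ∀ k : b.support, 0 < (c - cor b a - Pi.single i 1 : b.support → ℕ) k →
            0 ≤ P.pairingIn ℤ a k := fun k hk => hnonneg k (hk.trans_le (Nat.sub_le _ _))
        have hrec : ∀ c' ≤ c - cor b a, ∀ j : b.support, 0 < degPairing b c' j →
            heckeDeg b c' =
              heckeRefl b j * heckeDeg b (c' - Pi.single j 1) * heckeRefl b j :=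
          fun c' hc' j hj => ih _ ((Finset.sum_le_sum fun k _ => hc' k).trans_lt hlt) c' j hj rfl
        rw [heckeRefl_mul_heckeDeg hB ha.1 hnonneg hrec, e,
          ← heckeRefl_mul_heckeDeg hB ha.1 hnonneg' fun c' hc' => hrec c' (hc'.trans tsub_le_self)]
        have hcomm' := commute_heckeDeg hB ha.1 hnonneg'
        rw [← mul_assoc, mul_heckeRefl_of_pairing_pos ha.1 i hpos, hcomm'.eq, mul_assoc,
          heckeRefl_mul_of_pairing_pos ha.1 i hpos]
    · -- the simple root `i` does not occur in the degree which remains after removing `a`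
      have hz : (c - cor b a) i = 0 := by simp [heq]
      have hle : degPairing b (c - cor b a) i ≤ 0 := by
        by_contra! h
        exact absurd (pos_of_degPairing_pos h) (by omega)
      rcases eq_or_ne a i with rfl | hai
      · rw [← cor_simple, hcomm.eq, mul_assoc, ← hcomm.eq, ← mul_assoc, hcomm.eq, mul_assoc,
          heckeRefl_mul_self b i.2]
      · have hpos : 0 < P.pairingIn ℤ i a := by omega
        obtain ⟨hmax, hcor, hai0⟩ := ha.reflectionPerm hB hai heq hpos
        have h1 := ha.pairing_eq_one hB hai hpos
        have hcommi := commute_heckeDeg hB hipos (c := c - cor b a) fun k hk =>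
          (pairing_eq_zero_of_degPairing_eq_zero hz (by omega) hk).ge
        have e : c - Pi.single i 1 - cor b (P.reflectionPerm i a) = c - cor b a := by
          rw [hcor]
          funext k
          rcases eq_or_ne k i with rfl | hk
          · simp; omega
          · simp [hk]
        have hneg : P.pairingIn ℤ (P.reflectionPerm i a) i < 0 := by
          have : 0 < P.pairingIn ℤ a i := (P.zero_lt_pairingIn_iff' ℤ).1 hpos
          rw [← P.pairingIn_reflectionPerm, P.pairingIn_reflectionPerm_self_right]
          omega
        have hconj := heckeRefl_conj_of_pairing_neg hmax.1 i hneg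
        rw [P.reflectionPerm_self] at hconj
        rw [hmax.heckeDeg_eq hB, e, ← hconj]
        simp only [mul_assoc]
        rw [hcommi.eq]

end Recursion

section MinimalDegrees

variable {b : P.Base}

/-! ### Degrees on the full flag variety -/

variable (P) in
/-- The inclusion of `H₂(G/B)`, the coroot lattice, into `N`. -/
noncomputable def h2Inclusion : H2 P (∅ : Set ι) →ₗ[ℤ] N :=
  Submodule.liftQ _ (P.corootSpan ℤ).subtype (by
    intro x hx
    have hx' : (x : N) ∈ Submodule.span ℤ (P.coroot '' (∅ : Set ι)) := hx
    simpa using hx')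

lemma h2Inclusion_injective : Function.Injective (h2Inclusion P) := by
  rw [← LinearMap.ker_eq_bot]
  refine Submodule.ker_liftQ_eq_bot _ _ _ fun x hx => ?_
  have hx' : (x : N) = 0 := hx
  change (x : N) ∈ Submodule.span ℤ (P.coroot '' (∅ : Set ι))
  rw [hx']
  exact zero_mem _

lemma h2Inclusion_corootClass (i : ι) : h2Inclusion P (corootClass P ∅ i) = P.coroot i := rfl

variable (b) in
/-- The degree on the full flag variety with the given coefficients. -/
noncomputable def degOf (c : b.support → ℕ) : H2 P (∅ : Set ι) :=
  ∑ k : b.support, c k • corootClass P ∅ k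

lemma h2Inclusion_degOf (c : b.support → ℕ) :
    h2Inclusion P (degOf b c) = ∑ k : b.support, (c k : ℤ) • P.coroot k := by
  simp [degOf, h2Inclusion_corootClass]

lemma degOf_injective : Function.Injective (degOf b) := by
  intro c c' h
  have := congrArg (h2Inclusion P) h
  rw [h2Inclusion_degOf, h2Inclusion_degOf] at this
  have := eq_of_sum_coroot_eq (f := fun k => (c k : ℤ)) (g := fun k => (c' k : ℤ)) this
  funext k
  simpa using congrFun this k

lemma degOf_add (c c' : b.support → ℕ) : degOf b (c + c') = degOf b c + degOf b c' := by
  simp [degOf, add_smul, Finset.sum_add_distrib]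

lemma degOf_sub {c c' : b.support → ℕ} (h : c' ≤ c) :
    degOf b (c - c') = degOf b c - degOf b c' := by
  rw [eq_sub_iff_add_eq, ← degOf_add, tsub_add_cancel_of_le h]

lemma isDegree_iff {d : H2 P (∅ : Set ι)} : IsDegree b ∅ d ↔ ∃ c, d = degOf b c := by
  classical
  constructor
  · intro h
    induction h using AddSubmonoid.closure_induction with
    | mem x hx =>
      obtain ⟨i, hi, rfl⟩ := hx
      refine ⟨Pi.single ⟨i, hi⟩ 1, ?_⟩
      rw [degOf, Finset.sum_eq_single ⟨i, hi⟩ (by simp +contextual) (by simp)]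
      simp
    | zero => exact ⟨0, by simp [degOf]⟩
    | add x y _ _ hx hy =>
      obtain ⟨c, rfl⟩ := hx
      obtain ⟨c', rfl⟩ := hy
      exact ⟨c + c', (degOf_add c c').symm⟩
  · rintro ⟨c, rfl⟩
    exact sum_mem fun k _ =>
      nsmul_mem (AddSubmonoid.subset_closure (Set.mem_image_of_mem _ k.2)) _

lemma degLE_iff {c c' : b.support → ℕ} : DegLE b ∅ (degOf b c) (degOf b c') ↔ c ≤ c' := by
  rw [DegLE, isDegree_iff]
  constructor
  · rintro ⟨x, hx⟩
    rw [sub_eq_iff_eq_add, ← degOf_add] at hx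
    rw [degOf_injective hx]
    exact le_add_self
  · intro h
    exact ⟨c' - c, (degOf_sub h).symm⟩

lemma posRoots_empty : posRoots P (∅ : Set ι) = ∅ := by
  ext i
  simp [posRoots, P.ne_zero i]

variable {B : P.InvariantForm} (hB : ∀ x : M, x ≠ 0 → 0 < B.form x x)

include hB

lemma corootClass_eq {i : ι} (hi : b.IsPos i) : corootClass P ∅ i = degOf b (cor b i) := by
  apply h2Inclusion_injective
  rw [h2Inclusion_corootClass, h2Inclusion_degOf, coroot_eq_sum b i]
  exact Finset.sum_congr rfl fun k _ => by rw [cast_cor hB hi]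

lemma mem_rootsBelow_iff {c : b.support → ℕ} {i : ι} :
    i ∈ rootsBelow b ∅ (degOf b c) ↔ b.IsPos i ∧ cor b i ≤ c := by
  rw [rootsBelow, posRoots_empty, Set.sdiff_empty, Set.mem_ofPred_eq, mem_posRoots_support_iff]
  exact and_congr_right fun hi => by rw [corootClass_eq hB hi, degLE_iff]

lemma isMaximalRoot_iff {c : b.support → ℕ} {i : ι} :
    IsMaximalRoot b ∅ (degOf b c) i ↔ IsMaxRoot b c i := by
  simp only [IsMaximalRoot, mem_rootsBelow_iff hB, rootLE_iff, IsMaxRoot, and_assoc, and_imp]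

lemma isGreedy_iff {c : b.support → ℕ} {l : List ι} :
    IsGreedy b ∅ l (degOf b c) ↔ GreedyList b c l := by
  constructor
  · intro h
    generalize hd : degOf b c = d at h
    induction h generalizing c with
    | nil =>
      obtain rfl : c = 0 := degOf_injective (by rw [hd]; simp [degOf])
      exact .nil
    | @cons i l d hi _ ih =>
      subst hd
      rw [isMaximalRoot_iff hB] at hi
      exact .cons hi (ih (by rw [degOf_sub hi.2.1, corootClass_eq hB hi.1]))
  · intro h
    induction h with
    | nil =>
      have : degOf b 0 = 0 := by simp [degOf]
      rw [this]
      exact .nil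
    | @cons i l c hi _ ih =>
      refine .cons ((isMaximalRoot_iff hB).2 hi) ?_
      rwa [corootClass_eq hB hi.1, ← degOf_sub hi.2.1]

omit hB in
lemma longest_empty [Finite ι] [P.IsRootSystem] : longest b (∅ : Set ι) = 1 := by
  have h : IsLongest b ∅ (longest b ∅) := Classical.epsilon_spec (exists_isLongest b ∅)
  simpa [parabolicWeyl] using h.1

variable [Finite ι] [P.IsCrystallographic] [P.IsReduced]

lemma z_degOf [P.IsRootSystem] (c : b.support → ℕ) : z b ∅ (degOf b c) = heckeDeg b c := by
  have hfold : ∀ l : List ι, l.foldr (fun i w => heckeMul b (weylGroup.ofIdx P i) w) 1 =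
      heckeProd b l := by
    intro l
    induction l with
    | nil => rfl
    | cons i l ih => rw [List.foldr_cons, ih, heckeProd_cons]; rfl
  simp only [z, longest_empty, inv_one, hfold, heckeDeg, isGreedy_iff hB]
  exact mul_one (M := P.weylGroup) _

/-! ### Greedy decompositions of minimal degrees -/

omit hB in
variable (b) in
/-- A degree is irredundant if no smaller degree has the same Hecke product. -/
def IsIrredundant (c : b.support → ℕ) : Prop :=
  ∀ c' ≤ c, heckeDeg b c' = heckeDeg b c → c' = c

lemma IsMinimalDegree.exists_isIrredundant [P.IsRootSystem] {e : H2 P (∅ : Set ι)}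
    (he : IsMinimalDegree b ∅ e) : ∃ c, e = degOf b c ∧ IsIrredundant b c := by
  obtain ⟨h1, h2⟩ := he
  obtain ⟨c, rfl⟩ := isDegree_iff.1 h1
  refine ⟨c, rfl, fun c' hc' hz => degOf_injective (h2 _ (isDegree_iff.2 ⟨c', rfl⟩) ?_
    (degLE_iff.2 hc'))⟩
  rw [z_degOf hB, z_degOf hB, hz]
  exact Relation.ReflTransGen.refl

/-- In an irredundant degree, the support of what remains after removing a maximal root `a` is
orthogonal to `a`. -/
lemma IsIrredundant.pairing_eq_zero {c : b.support → ℕ} (hc : IsIrredundant b c) {a : ι}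
    (ha : IsMaxRoot b c a) {k : b.support} (hk : 0 < (c - cor b a) k) :
    P.pairingIn ℤ a k = 0 := by
  classical
  have hnonneg : ∀ k : b.support, 0 < (c - cor b a) k → 0 ≤ P.pairingIn ℤ a k := fun k hk =>
    ha.pairing_nonneg hB (by simp only [Pi.sub_apply] at hk; omega)
  have hle : cor b a + orthPart b a (c - cor b a) ≤ c := by
    refine (add_le_add_right (orthPart_le a _) _).trans ?_
    rw [add_tsub_cancel_of_le ha.2.1]
  have hz : heckeDeg b (cor b a + orthPart b a (c - cor b a)) = heckeDeg b c := by
    rw [ha.heckeDeg_eq hB, (ha.mono hle le_self_add).heckeDeg_eq hB, add_tsub_cancel_left,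
      heckeRefl_mul_heckeDeg hB ha.1 hnonneg fun c' _ i hi => heckeDeg_eq_conj hB c' i hi]
  have := congrFun (hc _ hle hz) k
  by_contra hne
  simp only [Pi.sub_apply, Pi.add_apply, orthPart, hne, if_false] at this hk
  omega

lemma IsIrredundant.sub {c : b.support → ℕ} (hc : IsIrredundant b c) {a : ι}
    (ha : IsMaxRoot b c a) : IsIrredundant b (c - cor b a) := by
  intro c' hc' hz
  have hle : cor b a + c' ≤ c := by
    refine (add_le_add_right hc' _).trans ?_
    rw [add_tsub_cancel_of_le ha.2.1]
  have := hc _ hle (by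
    rw [ha.heckeDeg_eq hB, (ha.mono hle le_self_add).heckeDeg_eq hB, add_tsub_cancel_left, hz])
  rw [← this, add_tsub_cancel_left]

/-- The relation between the earlier root `a` and the later root `a'` of a greedy decomposition
of a minimal degree: the support of `a'` is orthogonal to `a`, and `a + a'` is not a root. -/
def CascadeRel (b : P.Base) (a a' : ι) : Prop :=
  (∀ k : b.support, 0 < cor b a' k → P.pairingIn ℤ a k = 0) ∧
    ∀ j, P.root j ≠ P.root a + P.root a'

omit [Finite ι] [P.IsReduced] in
lemma pairing_eq_zero_of_support {a a' : ι} (ha' : b.IsPos a')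
    (h : ∀ k : b.support, 0 < cor b a' k → P.pairingIn ℤ a k = 0) : P.pairingIn ℤ a a' = 0 := by
  rw [← degPairing_cor hB ha']
  refine Finset.sum_eq_zero fun k _ => ?_
  rcases Nat.eq_zero_or_pos (cor b a' k) with h0 | h0
  · simp [h0]
  · simp [h k h0]

omit [Finite ι] [P.IsReduced] in
/-- If the sum of two orthogonal roots is a root `j`, then `j^∨` is half the sum of their
coroots. -/
lemma two_mul_corootCoeff_of_root_eq_add {a a' j : ι} (h0 : P.pairingIn ℤ a a' = 0)
    (hj : P.root j = P.root a + P.root a') (k : b.support) :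
    2 * corootCoeff b j k = corootCoeff b a k + corootCoeff b a' k := by
  have ho : B.form (P.root a) (P.root a') = 0 := by
    rw [B.apply_root_root_zero_iff, ← cast_pairingIn, h0, Int.cast_zero]
  have ho' : B.form (P.root a') (P.root a) = 0 := by rw [form_comm, ho]
  have hja := B.two_mul_apply_root_root a j
  have hja' := B.two_mul_apply_root_root a' j
  have hjj : B.form (P.root j) (P.root j) =
      B.form (P.root a) (P.root a) + B.form (P.root a') (P.root a') := by
    rw [hj]; simp [ho, ho']
  have pj := form_root_pos hB j
  have pa := form_root_pos hB a
  have pa' := form_root_pos hB a'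
  have e1 : B.form (P.root a) (P.root j) = B.form (P.root a) (P.root a) := by
    rw [hj, map_add, ho, add_zero]
  have e2 : B.form (P.root a') (P.root j) = B.form (P.root a') (P.root a') := by
    rw [hj, map_add, ho', zero_add]
  rw [e1, ← cast_pairingIn] at hja
  rw [e2, ← cast_pairingIn] at hja'
  -- the two positive integers `⟨a, j^∨⟩` and `⟨a', j^∨⟩` add up to `2`
  have m1 : 0 < P.pairingIn ℤ a j := by
    by_contra! hle
    have : (P.pairingIn ℤ a j : ℝ) ≤ 0 := by exact_mod_cast hle
    nlinarith
  have m2 : 0 < P.pairingIn ℤ a' j := by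
    by_contra! hle
    have : (P.pairingIn ℤ a' j : ℝ) ≤ 0 := by exact_mod_cast hle
    nlinarith
  have m3 : P.pairingIn ℤ a j + P.pairingIn ℤ a' j = 2 := by
    rw [← P.pairingIn_eq_add_of_root_eq_add hj, P.pairingIn_same]
  have m4 : (P.pairingIn ℤ a j : ℝ) = 1 := by exact_mod_cast (by omega : P.pairingIn ℤ a j = 1)
  have m5 : (P.pairingIn ℤ a' j : ℝ) = 1 := by
    exact_mod_cast (by omega : P.pairingIn ℤ a' j = 1)
  rw [m4] at hja
  rw [m5] at hja'
  have c1 := corootCoeff_mul_form (b := b) hB j k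
  have c2 := corootCoeff_mul_form (b := b) hB a k
  have c3 := corootCoeff_mul_form (b := b) hB a' k
  have hr : rootCoeff b j k = rootCoeff b a k + rootCoeff b a' k := by
    have : P.root j = (1 : ℤ) • P.root a + (1 : ℤ) • P.root a' := by simpa using hj
    rw [rootCoeff_eq_of_root_eq this]; simp
  rw [hr] at c1
  push_cast at c1
  have : (2 * corootCoeff b j k : ℝ) = corootCoeff b a k + corootCoeff b a' k := by
    refine mul_right_cancel₀ pa.ne' ?_
    have s1 : B.form (P.root j) (P.root j) = 2 * B.form (P.root a) (P.root a) := by linarith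
    have s2 : B.form (P.root a') (P.root a') = B.form (P.root a) (P.root a) := by linarith
    rw [s1] at c1
    rw [s2] at c3
    linear_combination c1 - c2 - c3
  exact_mod_cast this

omit [Finite ι] [P.IsReduced] in
lemma IsMaxRoot.cascadeRel {c : b.support → ℕ} {a a' : ι} (ha : IsMaxRoot b c a)
    (ha' : b.IsPos a') (hle : cor b a' ≤ c - cor b a)
    (horth : ∀ k : b.support, 0 < cor b a' k → P.pairingIn ℤ a k = 0) : CascadeRel b a a' := by
  refine ⟨horth, fun j hj => ?_⟩
  have h0 := pairing_eq_zero_of_support hB ha' horth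
  have hr : rootCoeff b a ≤ rootCoeff b j := by
    have : P.root j = (1 : ℤ) • P.root a + (1 : ℤ) • P.root a' := by simpa using hj
    rw [rootCoeff_eq_of_root_eq this, one_smul, one_smul]
    exact le_add_of_nonneg_right (rootCoeff_nonneg ha')
  have hjpos : b.IsPos j := isPos_of_rootCoeff_nonneg ((rootCoeff_nonneg ha.1).trans hr)
  have hjc : cor b j ≤ c := by
    intro k
    have h1 := two_mul_corootCoeff_of_root_eq_add (b := b) hB h0 hj k
    rw [← cast_cor hB hjpos, ← cast_cor hB ha.1, ← cast_cor hB ha'] at h1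
    have h2 : cor b a k ≤ c k := ha.2.1 k
    have h3 : cor b a' k ≤ c k - cor b a k := hle k
    change cor b j k ≤ c k
    omega
  rw [ha.2.2 j hjpos hjc hr] at hj
  exact P.ne_zero a' (by simpa using hj)

omit hB [Finite ι] [P.IsCrystallographic] [P.IsReduced] in
lemma GreedyList.isPos_and_le {c : b.support → ℕ} {l : List ι} (h : GreedyList b c l) {a : ι}
    (ha : a ∈ l) : b.IsPos a ∧ cor b a ≤ c := by
  induction h with
  | nil => simp at ha
  | cons hi _ ih =>
    rcases List.mem_cons.1 ha with rfl | ha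
    · exact ⟨hi.1, hi.2.1⟩
    · exact ⟨(ih ha).1, (ih ha).2.trans tsub_le_self⟩

/-- Any two roots in a greedy decomposition of an irredundant degree are strongly orthogonal, and
one of them is orthogonal to the support of the other. -/
lemma GreedyList.cascadeRel {c : b.support → ℕ} {l : List ι} (h : GreedyList b c l)
    (hc : IsIrredundant b c) {a a' : ι} (ha : a ∈ l) (ha' : a' ∈ l) (hne : a ≠ a') :
    CascadeRel b a a' ∨ CascadeRel b a' a := by
  induction h with
  | nil => simp at ha
  | @cons i l c hi hl ih =>
    have key : ∀ x ∈ l, CascadeRel b i x := by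
      intro x hx
      obtain ⟨h1, h2⟩ := hl.isPos_and_le hx
      exact hi.cascadeRel hB h1 h2 fun k hk => hc.pairing_eq_zero hB hi (hk.trans_le (h2 k))
    rcases List.mem_cons.1 ha with rfl | h1 <;> rcases List.mem_cons.1 ha' with rfl | h2
    · exact absurd rfl hne
    · exact Or.inl (key _ h2)
    · exact Or.inr (key _ h1)
    · exact ih (hc.sub hB hi) h1 h2

/-- Any two distinct roots in the cascade of a minimal degree are strongly orthogonal, and one of
them is orthogonal to the support of the other. -/
lemma cascadeRel_of_mem_cascade [P.IsRootSystem] {e : H2 P (∅ : Set ι)}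
    (he : IsMinimalDegree b ∅ e) {a a' : ι} (ha : a ∈ cascade b e) (ha' : a' ∈ cascade b e)
    (hne : a ≠ a') : CascadeRel b a a' ∨ CascadeRel b a' a := by
  obtain ⟨c, rfl, hc⟩ := he.exists_isIrredundant hB
  obtain ⟨-, l, hl, hal⟩ := ha
  obtain ⟨-, l', hl', hal'⟩ := ha'
  rw [isGreedy_iff hB] at hl hl'
  exact hl.cascadeRel hB hc hal ((hl.unique hB hl').1.mem_iff.2 hal') hne

omit [Finite ι] [P.IsReduced] in
lemma CascadeRel.root_ne_sub {a a' : ι} (h : CascadeRel b a a') (ha' : b.IsPos a') (j : ι) :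
    P.root j ≠ P.root a - P.root a' := by
  intro hj
  have h0 := pairing_eq_zero_of_support hB ha' h.1
  have h0' : P.pairing a a' = 0 := by rw [← cast_pairingIn, h0, Int.cast_zero]
  refine h.2 (P.reflectionPerm a' j) ?_
  rw [P.root_reflectionPerm, hj, map_sub, P.reflection_apply_self, P.reflection_apply_root, h0',
    zero_smul, sub_zero, sub_neg_eq_add]

omit [Finite ι] [P.IsReduced] in
lemma CascadeRel.root_ne_sub' {a a' : ι} (h : CascadeRel b a a') (ha' : b.IsPos a') (j : ι) :
    P.root j ≠ P.root a' - P.root a := by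
  intro hj
  refine h.root_ne_sub hB ha' (P.reflectionPerm j j) ?_
  rw [P.root_reflectionPerm, P.reflection_apply_self, hj, neg_sub]

omit hB [Finite ι] [P.IsReduced] in
lemma pairingIn_add_eq_add {a g a' g' : ι} (h : P.root a + P.root g = P.root a' + P.root g')
    (x : ι) : P.pairingIn ℤ a x + P.pairingIn ℤ g x = P.pairingIn ℤ a' x + P.pairingIn ℤ g' x := by
  have := congrArg (fun v => P.toLinearMap v (P.coroot x)) h
  simp only [map_add, LinearMap.add_apply, root_coroot_eq_pairing, ← cast_pairingIn] at this
  exact_mod_cast this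

/-- The heart of the injectivity: an equality `a + g = a' + g'` would make one of `g - a'` and
`a - a'` a root. -/
lemma CascadeRel.false_of_add_eq_add {J : Set ι} (hJ : J ⊆ b.support) {a a' g g' : ι}
    (h : CascadeRel b a a') (ha : b.IsPos a) (ha' : b.IsPos a') (haJ : a ∉ posRoots P J)
    (haJ' : a' ∉ posRoots P J) (hg : g ∈ posRoots P J) (hg' : g' ∈ posRoots P J)
    (heq : P.root a + P.root g = P.root a' + P.root g')
    (hag : P.pairingIn ℤ a g < 0) (hag' : P.pairingIn ℤ a' g' < 0) : False := by
  have hgm := (mem_posRoots_iff hJ).1 hg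
  have hgm' := (mem_posRoots_iff hJ).1 hg'
  have haa' := pairing_eq_zero_of_support hB ha' h.1
  have haa : P.pairingIn ℤ a' a = 0 := P.pairingIn_eq_zero_iff.1 haa'
  have key : ∀ j, P.root j ≠ P.root g - P.root a' := by
    intro j hj
    have hr : ∀ k, rootCoeff b j k = rootCoeff b g k - rootCoeff b a' k := by
      have : P.root j = (1 : ℤ) • P.root g + (-1 : ℤ) • P.root a' := by
        rw [hj]; simp [sub_eq_add_neg]
      rw [rootCoeff_eq_of_root_eq this]
      intro k; simp [sub_eq_add_neg]
    rcases rootCoeff_nonneg_or_nonpos (b := b) j with hs | hs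
    · refine haJ' ((mem_posRoots_iff hJ).2 ⟨ha', fun k hk => hgm.2 k ?_⟩)
      have h1 : 0 ≤ rootCoeff b j k := hs k
      have h2 : 0 ≤ rootCoeff b a' k := rootCoeff_nonneg ha' k
      have := hr k
      omega
    · refine hag.ne (pairing_eq_zero_of_support hB hgm.1 fun k hk => h.1 k ?_)
      rw [cor_pos_iff hB] at hk ⊢
      have h1 : rootCoeff b j k ≤ 0 := hs k
      have := hr k
      omega
  have hag1 : P.pairingIn ℤ g a < 0 := (P.pairingIn_lt_zero_iff ℤ).1 hag
  have e1 := pairingIn_add_eq_add heq a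
  have e2 := pairingIn_add_eq_add heq a'
  have e3 := pairingIn_add_eq_add heq g
  rw [P.pairingIn_same] at e1 e2 e3
  have hga' : P.pairingIn ℤ g a' ≤ 0 := by
    by_contra! hpos
    obtain ⟨j, hj⟩ := P.root_sub_root_mem_of_pairingIn_pos hpos (by rintro rfl; exact haJ' hg)
    exact key j hj
  have hga : P.pairingIn ℤ g' a ≤ 0 := by
    by_contra! hpos
    obtain ⟨j, hj⟩ := P.root_sub_root_mem_of_pairingIn_pos hpos (by rintro rfl; exact haJ hg')
    refine key j ?_
    rw [hj, sub_eq_sub_iff_add_eq_add, add_comm, ← heq, add_comm]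
  -- now `⟨g, a^∨⟩ ≤ -2`, so that `g` is longer than `a`, and `g`, `g'` form an acute angle
  have h1 : P.pairingIn ℤ a g = -1 :=
    (pairing_eq_neg_one_or ha hgm.1 hag).resolve_right (by omega)
  have h2 : P.pairingIn ℤ a' g ≤ 0 := by
    by_contra! hpos
    have := (P.zero_lt_pairingIn_iff' ℤ).1 hpos
    omega
  have hgg : g' ≠ g := by
    rintro rfl
    have : a = a' := P.root.injective (add_right_cancel heq)
    rw [this, P.pairingIn_same] at haa
    omega
  obtain ⟨j, hj⟩ := P.root_sub_root_mem_of_pairingIn_pos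
    (show 0 < P.pairingIn ℤ g' g by omega) hgg
  refine h.root_ne_sub hB ha' j ?_
  rw [hj, sub_eq_sub_iff_add_eq_add, add_comm, ← heq, add_comm]

end MinimalDegrees

end FlagDegree


theorem theorem6p1 {ι M N : Type*} [Finite ι] [AddCommGroup M] [Module ℝ M]
    [AddCommGroup N] [Module ℝ N] (P : RootPairing ι ℝ M N) [P.IsRootSystem]
    [P.IsCrystallographic] [P.IsReduced] [P.IsIrreducible] (b : P.Base)
    (J : Set ι) (hJ : J ⊆ b.support)
    (B : P.InvariantForm) (hB : ∀ x : M, x ≠ 0 → 0 < B.form x x)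
    (d : FlagDegree.H2 P J) (hd : FlagDegree.IsMinimalDegree b J d)
    (e : FlagDegree.H2 P (∅ : Set ι)) (he : FlagDegree.IsLifting b J d e) :
    Set.MapsTo (fun p : ι × ι => -P.root p.1 - P.root p.2)
        {p : ι × ι | p.1 ∈ FlagDegree.cascade b e \ FlagDegree.posRoots P J ∧
          p.2 ∈ FlagDegree.posRoots P J ∧ B.form (P.root p.1) (P.root p.2) < 0}
        (FlagDegree.tangentDirections b J e \
          -(P.root '' (FlagDegree.cascade b e \ FlagDegree.posRoots P J))) ∧
      Set.InjOn (fun p : ι × ι => -P.root p.1 - P.root p.2)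
        {p : ι × ι | p.1 ∈ FlagDegree.cascade b e \ FlagDegree.posRoots P J ∧
          p.2 ∈ FlagDegree.posRoots P J ∧ B.form (P.root p.1) (P.root p.2) < 0} := by
  have hmin := he.1
  have hpos : ∀ {i}, i ∈ FlagDegree.cascade b e → b.IsPos i := fun h =>
    FlagDegree.mem_posRoots_support_iff.1 h.1
  have hneg : ∀ {i j}, B.form (P.root i) (P.root j) < 0 → P.pairingIn ℤ i j < 0 := by
    intro i j h
    have h1 := B.two_mul_apply_root_root i j
    have h2 := FlagDegree.form_root_pos hB j
    rw [← FlagDegree.cast_pairingIn] at h1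
    by_contra! h3
    have : (0 : ℝ) ≤ P.pairingIn ℤ i j := by exact_mod_cast h3
    nlinarith [mul_nonneg this h2.le]
  constructor
  · rintro ⟨a, g⟩ ⟨⟨ha, haJ⟩, hg, hag⟩
    dsimp only at ha haJ hg hag
    have hapos := hpos ha
    have hgm := (FlagDegree.mem_posRoots_iff hJ).1 hg
    refine ⟨⟨?_, a, ⟨ha, haJ⟩, P.root g, Or.inr ⟨g, hg, rfl⟩, rfl⟩, ?_⟩
    · obtain ⟨j, hj⟩ := P.root_add_root_mem_of_pairingIn_neg (hneg hag) fun h => by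
        rw [P.root_eq_neg_iff] at h
        rw [h, FlagDegree.isPos_reflectionPerm_self_iff] at hapos
        exact hapos hgm.1
      have hr : ∀ k, FlagDegree.rootCoeff b j k =
          FlagDegree.rootCoeff b a k + FlagDegree.rootCoeff b g k := by
        have : P.root j = (1 : ℤ) • P.root a + (1 : ℤ) • P.root g := by simpa using hj
        rw [FlagDegree.rootCoeff_eq_of_root_eq this]
        intro k; simp
      have ra : ∀ k, 0 ≤ FlagDegree.rootCoeff b a k := FlagDegree.rootCoeff_nonneg hapos
      have rg : ∀ k, 0 ≤ FlagDegree.rootCoeff b g k := FlagDegree.rootCoeff_nonneg hgm.1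
      rw [Set.mem_neg]
      refine ⟨j, ⟨FlagDegree.mem_posRoots_support_iff.2
        (FlagDegree.isPos_of_rootCoeff_nonneg fun k => ?_), fun hjJ => haJ ?_⟩, ?_⟩
      · have := hr k
        have := ra k
        have := rg k
        simp only [Pi.zero_apply]
        omega
      · refine (FlagDegree.mem_posRoots_iff hJ).2 ⟨hapos, fun k hk => ?_⟩
        refine ((FlagDegree.mem_posRoots_iff hJ).1 hjJ).2 k ?_
        have := hr k
        have := ra k
        have := rg k
        omega
      · rw [hj]
        simp only [neg_sub]
        abel
    · rw [Set.mem_neg]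
      rintro ⟨i, ⟨hi, hiJ⟩, hia⟩
      have hia' : P.root g = P.root i - P.root a := by
        rw [hia]; simp only; abel
      have hne : a ≠ i := by
        rintro rfl
        exact P.ne_zero g (by rw [hia', sub_self])
      rcases FlagDegree.cascadeRel_of_mem_cascade hB hmin ha hi hne with h | h
      · exact h.root_ne_sub' hB (hpos hi) g hia'
      · exact h.root_ne_sub hB hapos g hia'
  · rintro ⟨a, g⟩ ⟨⟨ha, haJ⟩, hg, hag⟩ ⟨a', g'⟩ ⟨⟨ha', haJ'⟩, hg', hag'⟩ heq
    have heq' : P.root a + P.root g = P.root a' + P.root g' := by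
      simp only at heq
      rw [← neg_inj, neg_add', neg_add', heq]
    by_cases hne : a = a'
    · subst hne
      exact Prod.ext rfl (P.root.injective (add_left_cancel heq'))
    · exfalso
      rcases FlagDegree.cascadeRel_of_mem_cascade hB hmin ha ha' hne with h | h
      · exact h.false_of_add_eq_add hB hJ (hpos ha) (hpos ha') haJ haJ' hg hg' heq'
          (hneg hag) (hneg hag')
      · exact h.false_of_add_eq_add hB hJ (hpos ha') (hpos ha) haJ' haJ hg' hg heq'.symm
          (hneg hag') (hneg hag)
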